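/- Let $(M^7,g)$ be a Riemannian manifold with holonomy in $G_2$, i.e. equipped with a smooth $3$-form $\Phi$ that is parallel for the Levi-Civita connection $\nabla$ and at each point equals $e^{123}+e^{145}+e^{167}+e^{246}-e^{257}-e^{347}-e^{356}$ in some orthonormal basis, and let $\times$ be the vector product $\langle u\times v,w\rangle=\Phi(u,v,w)$. Let $Y^3\subset M$ be an associative submanifold with boundary (embedded or immersed), i.e. a $3$-dimensional submanifold whose tangent spaces are stable under $\times$. Let $\nu$ be its normal bundle, $\nabla^\perp$ the connection on $\nu$ induced by $\nabla$, and $n$ the inner unit normal vector field of $\partial Y$ in $Y$. Let $L$ be a smooth real plane subbundle of $\nu|_{\partial Y}$ that is invariant under $n\times$, and $\pi_L$ the orthogonal projection onto $L$. For a smooth local section $\varphi$ of $L$ and an oriented orthonormal frame $(v,\,w=n\times v)$ of $T\partial Y$ put $$\mathcal D_L\varphi=\pi_L\bigl(v\times\nabla^\perp_w\varphi-w\times\nabla^\perp_v\varphi\bigr).$$ Then oriented orthonormal frames exist at every point of $\partial Y$; $\mathcal D_L\varphi$ does not depend on the choice of the frame; $\mathcal D_L$ maps smooth sections of $L$ to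 smooth sections of $L$ and is of order $0$, i.e. there is a field of linear endomorphisms $A_s:L_s\to L_s$ ($s\in\partial Y$) with $(\mathcal D_L\varphi)(s)=A_s\,\varphi(s)$ for all $\varphi$ and $s$; every $A_s$ is symmetric; and $\operatorname{tr}A_s=2H(s)$, where $H$ is the mean curvature of $\partial Y$ in $Y$ with respect to the outer normal $-n$, that is, $H=\tfrac12(k_1+k_2)$ with $k_1,k_2$ the principal curvatures, the eigenvalues of $u\mapsto \nabla^{\top}_u(-n)$ on $T\partial Y$, where $\nabla^\top$ is the component of $\nabla$ tangent to $Y$ (positive on the boundary of a round ball). -/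

import Mathlib

open Bundle Manifold
open scoped ContDiff

namespace AssociativeBoundary

noncomputable section

/-! ### Linear algebra of `G₂`-forms -/

/-- The elementary three-form `eⁱ ∧ eʲ ∧ eᵏ` on `ℝ⁷`. -/
def wedge (i j k : Fin 7) (u v w : EuclideanSpace ℝ (Fin 7)) : ℝ :=
  Matrix.det !![u i, u j, u k; v i, v j, v k; w i, w j, w k]

/-- The model `G₂`-form
`e¹²³ + e¹⁴⁵ + e¹⁶⁷ + e²⁴⁶ - e²⁵⁷ - e³⁴⁷ - e³⁵⁶` on `ℝ⁷` (indices start at `0` in the code). -/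
def modelForm (u v w : EuclideanSpace ℝ (Fin 7)) : ℝ :=
  wedge 0 1 2 u v w + wedge 0 3 4 u v w + wedge 0 5 6 u v w + wedge 1 3 5 u v w
    - wedge 1 4 6 u v w - wedge 2 3 6 u v w - wedge 2 4 5 u v w

section LinearAlgebra

variable {V : Type*} [NormedAddCommGroup V] [InnerProductSpace ℝ V]

/-- A three-form on a Euclidean space is a `G₂`-form inducing the given inner product if it is
the model form in some orthonormal basis. -/
def IsG2Form (Φ : V [⋀^Fin 3]→ₗ[ℝ] ℝ) : Prop :=
  ∃ b : OrthonormalBasis (Fin 7) ℝ V,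
    ∀ u v w : V, Φ ![u, v, w] = modelForm (b.repr u) (b.repr v) (b.repr w)

variable [FiniteDimensional ℝ V]

/-- The vector product defined by a three-form: `⟪u × v, w⟫ = Φ(u, v, w)` for all `w`
(see `inner_cross`). -/
def cross (Φ : V [⋀^Fin 3]→ₗ[ℝ] ℝ) (u v : V) : V :=
  ∑ i, Φ ![u, v, stdOrthonormalBasis ℝ V i] • stdOrthonormalBasis ℝ V i

theorem inner_cross (Φ : V [⋀^Fin 3]→ₗ[ℝ] ℝ) (u v w : V) :
    inner ℝ (cross Φ u v) w = Φ ![u, v, w] := by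
  set b := stdOrthonormalBasis ℝ V with hb
  have h : ∀ x : V, Φ ![u, v, x] = Φ.toMultilinearMap.toLinearMap ![u, v, 0] 2 x := by
    intro x
    rw [MultilinearMap.toLinearMap_apply]
    refine congrArg Φ ?_
    funext i
    fin_cases i <;> rfl
  conv_rhs => rw [h, ← b.sum_repr' w, map_sum]
  rw [cross, sum_inner]
  refine Finset.sum_congr rfl fun i _ => ?_
  rw [real_inner_smul_left, map_smul, ← h, smul_eq_mul, mul_comm]

end LinearAlgebra

/-! ### The ambient `G₂`-manifold -/

section Ambient

variable {M : Type*} [TopologicalSpace M] [ChartedSpace (EuclideanSpace ℝ (Fin 7)) M]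

instance (x : M) : FiniteDimensional ℝ (TangentSpace (𝓡 7) x) :=
  inferInstanceAs (FiniteDimensional ℝ (EuclideanSpace ℝ (Fin 7)))

variable [IsManifold (𝓡 7) ∞ M] [RiemannianBundle (fun x : M => TangentSpace (𝓡 7) x)]
  [IsContMDiffRiemannianBundle (𝓡 7) ∞ (EuclideanSpace ℝ (Fin 7))
    (fun x : M => TangentSpace (𝓡 7) x)]

instance : IsContMDiffRiemannianBundle (𝓡 7) 1 (EuclideanSpace ℝ (Fin 7))
    (fun x : M => TangentSpace (𝓡 7) x) :=
  IsContMDiffRiemannianBundle.of_le (n := ∞) (by exact_mod_cast le_top)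

/-- The Levi-Civita connection: the torsion-free smooth affine connection preserving the
metric. The value of `∇_w X` at `x` is written `nabla X x w`. -/
structure IsLeviCivita (nabla : CovariantDerivative (𝓡 7) (EuclideanSpace ℝ (Fin 7))
    (fun x : M => TangentSpace (𝓡 7) x)) : Prop where
  smooth : nabla.ContMDiffCovariantDerivative ∞
  torsion_eq_zero : nabla.torsion = 0
  metric : nabla.IsMetricCompatible

/-- A torsion-free `G₂`-structure inducing the metric: a smooth three-form `Φ`, equal at each
point to the model form in some orthonormal basis, and parallel for the connection `nabla`. -/
structure IsTorsionFreeG2Structure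
    (nabla : CovariantDerivative (𝓡 7) (EuclideanSpace ℝ (Fin 7))
      (fun x : M => TangentSpace (𝓡 7) x))
    (Φ : (x : M) → TangentSpace (𝓡 7) x [⋀^Fin 3]→ₗ[ℝ] ℝ) : Prop where
  isG2Form : ∀ x, IsG2Form (Φ x)
  smooth : ∀ (X Y Z : (x : M) → TangentSpace (𝓡 7) x) (x : M),
    ContMDiffAt (𝓡 7) (𝓡 7).tangent ∞ (fun y => (⟨y, X y⟩ : TangentBundle (𝓡 7) M)) x →
    ContMDiffAt (𝓡 7) (𝓡 7).tangent ∞ (fun y => (⟨y, Y y⟩ : TangentBundle (𝓡 7) M)) x →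
    ContMDiffAt (𝓡 7) (𝓡 7).tangent ∞ (fun y => (⟨y, Z y⟩ : TangentBundle (𝓡 7) M)) x →
    ContMDiffAt (𝓡 7) 𝓘(ℝ, ℝ) ∞ (fun y => Φ y ![X y, Y y, Z y]) x
  parallel : ∀ (X Y Z : (x : M) → TangentSpace (𝓡 7) x) (x : M),
    MDifferentiableAt (𝓡 7) (𝓡 7).tangent (fun y => (⟨y, X y⟩ : TangentBundle (𝓡 7) M)) x →
    MDifferentiableAt (𝓡 7) (𝓡 7).tangent (fun y => (⟨y, Y y⟩ : TangentBundle (𝓡 7) M)) x →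
    MDifferentiableAt (𝓡 7) (𝓡 7).tangent (fun y => (⟨y, Z y⟩ : TangentBundle (𝓡 7) M)) x →
    ∀ w : TangentSpace (𝓡 7) x,
      mvfderiv (𝓡 7) (fun y => Φ y ![X y, Y y, Z y]) x w =
        Φ x ![nabla X x w, Y x, Z x] + Φ x ![X x, nabla Y x w, Z x]
          + Φ x ![X x, Y x, nabla Z x w]

end Ambient

/-! ### Vector fields along a surface mapped to `M` -/

section AlongMap

variable {M : Type*} [TopologicalSpace M] [ChartedSpace (EuclideanSpace ℝ (Fin 7)) M]
  [IsManifold (𝓡 7) ∞ M]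
  {S : Type*} [TopologicalSpace S] [ChartedSpace (EuclideanSpace ℝ (Fin 2)) S]

/-- Smoothness on `U` of a vector field `ξ` along `F : S → M`. -/
def SmoothAlongOn (F : S → M) (ξ : (s : S) → TangentSpace (𝓡 7) (F s)) (U : Set S) : Prop :=
  ContMDiffOn (𝓡 2) (𝓡 7).tangent ∞ (fun s => (⟨F s, ξ s⟩ : TangentBundle (𝓡 7) M)) U

/-- The covariant derivative `∇_w ξ` at `s` of a vector field `ξ` along `F : S → M`, i.e. the
pull-back connection: if `ξ = ∑ cᵢ Eᵢ ∘ F` in a local frame `E` of `TM` near `F s`, then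
`∇_w ξ = ∑ (dcᵢ(w) Eᵢ + cᵢ ∇_{dF(w)} Eᵢ)`. The frame used is the coordinate frame of the
preferred chart at `F s`. -/
def covAlong (nabla : CovariantDerivative (𝓡 7) (EuclideanSpace ℝ (Fin 7))
      (fun x : M => TangentSpace (𝓡 7) x))
    (F : S → M) (ξ : (s : S) → TangentSpace (𝓡 7) (F s)) (s : S)
    (w : TangentSpace (𝓡 2) s) : TangentSpace (𝓡 7) (F s) :=
  let e := trivializationAt (EuclideanSpace ℝ (Fin 7)) (fun x : M => TangentSpace (𝓡 7) x) (F s)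
  let b := (EuclideanSpace.basisFun (Fin 7) ℝ).toBasis
  ∑ i, (mvfderiv (𝓡 2) (fun t => e.localFrameCoeff (𝓡 7) b i (F t) (ξ t)) s w •
        e.localFrame b i (F s)
      + e.localFrameCoeff (𝓡 7) b i (F s) (ξ s) •
        nabla (e.localFrame b i) (F s) (mfderiv (𝓡 2) (𝓡 7) F s w))

/-- A smooth real plane subbundle of `F^* TM`. -/
structure IsSmoothPlaneBundle (F : S → M)
    (L : (s : S) → Submodule ℝ (TangentSpace (𝓡 7) (F s))) : Prop where
  finrank_eq : ∀ s, Module.finrank ℝ (L s) = 2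
  exists_frame : ∀ s, ∃ U : Set S, IsOpen U ∧ s ∈ U ∧
    ∃ a b : (t : S) → TangentSpace (𝓡 7) (F t), SmoothAlongOn F a U ∧ SmoothAlongOn F b U ∧
      ∀ t ∈ U, L t = Submodule.span ℝ {a t, b t}

/-- `ξ` is a smooth section over the open set `U` of the subbundle `L` of `F^* TM`
(its values outside `U` are irrelevant). -/
structure IsSectionOn (F : S → M) (L : (s : S) → Submodule ℝ (TangentSpace (𝓡 7) (F s)))
    (U : Set S) (ξ : (s : S) → TangentSpace (𝓡 7) (F s)) : Prop where
  mem : ∀ s ∈ U, ξ s ∈ L s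
  smooth : SmoothAlongOn F ξ U

end AlongMap

/-! ### Submanifolds with boundary, and the operator `𝒟_L` -/

section Boundary

variable {M : Type*} [TopologicalSpace M] [ChartedSpace (EuclideanSpace ℝ (Fin 7)) M]
  {Y : Type*} [TopologicalSpace Y] [ChartedSpace (EuclideanHalfSpace 3) Y]
  {S : Type*} [TopologicalSpace S] [ChartedSpace (EuclideanSpace ℝ (Fin 2)) S]

/-- `f : Y → M` is a smooth immersion, so that `Y` is a (possibly immersed) submanifold with
boundary of `M`. -/
structure IsSubmanifold (f : Y → M) : Prop where
  smooth : ContMDiff (𝓡∂ 3) (𝓡 7) ∞ f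
  injective : ∀ y, Function.Injective (mfderiv (𝓡∂ 3) (𝓡 7) f y)

/-- `j : S → Y` identifies the surface `S` with the boundary of `Y`: it is a smooth embedding
whose image is `∂Y`. -/
structure IsBoundaryInclusion (j : S → Y) : Prop where
  isEmbedding : Topology.IsEmbedding j
  range_eq : Set.range j = (𝓡∂ 3).boundary Y
  smooth : ContMDiff (𝓡 2) (𝓡∂ 3) ∞ j
  injective : ∀ s, Function.Injective (mfderiv (𝓡 2) (𝓡∂ 3) j s)

/-- The tangent space of `Y` at `y`, as a subspace of the tangent space of `M`. -/
def tangentY (f : Y → M) (y : Y) : Submodule ℝ (TangentSpace (𝓡 7) (f y)) :=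
  LinearMap.range (mfderiv (𝓡∂ 3) (𝓡 7) f y).toLinearMap

/-- The tangent space of `∂Y` at the boundary point `j s`, as a subspace of the tangent space
of `M`. -/
def tangentBoundary (f : Y → M) (j : S → Y) (s : S) :
    Submodule ℝ (TangentSpace (𝓡 7) ((f ∘ j) s)) :=
  LinearMap.range (mfderiv (𝓡 2) (𝓡 7) (f ∘ j) s).toLinearMap

variable [IsManifold (𝓡 7) ∞ M] [RiemannianBundle (fun x : M => TangentSpace (𝓡 7) x)]

/-- The normal space `ν` of `Y` at `y`. -/
def normalY (f : Y → M) (y : Y) : Submodule ℝ (TangentSpace (𝓡 7) (f y)) :=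
  (tangentY f y)ᗮ

/-- `Y` is associative: its tangent spaces are stable under the vector product. -/
def IsAssociative (Φ : (x : M) → TangentSpace (𝓡 7) x [⋀^Fin 3]→ₗ[ℝ] ℝ) (f : Y → M) : Prop :=
  ∀ y, ∀ u ∈ tangentY f y, ∀ v ∈ tangentY f y, cross (Φ (f y)) u v ∈ tangentY f y

/-- `n` is the inner unit normal vector field of `∂Y` in `Y`. A vector of `T_yY` at a boundary
point points inwards if its first coordinate in a chart with values in the half-space
`{x₀ ≥ 0}` is positive. -/
structure IsInnerUnitNormal (f : Y → M) (j : S → Y)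
    (n : (s : S) → TangentSpace (𝓡 7) ((f ∘ j) s)) : Prop where
  smooth : SmoothAlongOn (f ∘ j) n Set.univ
  norm_eq_one : ∀ s, ‖n s‖ = 1
  orthogonal : ∀ s, n s ∈ (tangentBoundary f j s)ᗮ
  inward : ∀ s, ∃ z : TangentSpace (𝓡∂ 3) (j s), mfderiv (𝓡∂ 3) (𝓡 7) f (j s) z = n s ∧
    0 < (show EuclideanSpace ℝ (Fin 3) from
      mfderiv (𝓡∂ 3) 𝓘(ℝ, EuclideanSpace ℝ (Fin 3)) (extChartAt (𝓡∂ 3) (j s)) (j s) z) 0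

/-- `(v, w)` is an oriented orthonormal frame of `T_s ∂Y`: `v` and `w` are orthonormal and
`w = n × v`. -/
structure IsOrientedFrame (Φ : (x : M) → TangentSpace (𝓡 7) x [⋀^Fin 3]→ₗ[ℝ] ℝ)
    (f : Y → M) (j : S → Y) (n : (s : S) → TangentSpace (𝓡 7) ((f ∘ j) s))
    (s : S) (v w : TangentSpace (𝓡 2) s) : Prop where
  norm_fst : ‖mfderiv (𝓡 2) (𝓡 7) (f ∘ j) s v‖ = 1
  norm_snd : ‖mfderiv (𝓡 2) (𝓡 7) (f ∘ j) s w‖ = 1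
  inner_eq_zero : inner ℝ (mfderiv (𝓡 2) (𝓡 7) (f ∘ j) s v)
    (mfderiv (𝓡 2) (𝓡 7) (f ∘ j) s w) = 0
  snd_eq : mfderiv (𝓡 2) (𝓡 7) (f ∘ j) s w =
    cross (Φ ((f ∘ j) s)) (n s) (mfderiv (𝓡 2) (𝓡 7) (f ∘ j) s v)

variable (nabla : CovariantDerivative (𝓡 7) (EuclideanSpace ℝ (Fin 7))
  (fun x : M => TangentSpace (𝓡 7) x))

/-- `∇^⊥_w ξ`: the component normal to `Y` of the covariant derivative of `ξ` along `∂Y`. -/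
def normalDeriv (f : Y → M) (j : S → Y) (ξ : (s : S) → TangentSpace (𝓡 7) ((f ∘ j) s))
    (s : S) (w : TangentSpace (𝓡 2) s) : TangentSpace (𝓡 7) ((f ∘ j) s) :=
  (normalY f (j s)).starProjection (covAlong nabla (f ∘ j) ξ s w)

/-- `∇^⊤_w ξ`: the component tangent to `Y` of the covariant derivative of `ξ` along `∂Y`. -/
def tangentialDeriv (f : Y → M) (j : S → Y) (ξ : (s : S) → TangentSpace (𝓡 7) ((f ∘ j) s))
    (s : S) (w : TangentSpace (𝓡 2) s) : TangentSpace (𝓡 7) ((f ∘ j) s) :=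
  (tangentY f (j s)).starProjection (covAlong nabla (f ∘ j) ξ s w)

/-- The first fundamental form of `∂Y` in the coordinate basis of `T_s ∂Y`. -/
def firstForm (f : Y → M) (j : S → Y) (s : S) : Matrix (Fin 2) (Fin 2) ℝ :=
  let d : Fin 2 → TangentSpace (𝓡 2) s := fun a => EuclideanSpace.basisFun (Fin 2) ℝ a
  Matrix.of fun a b => inner ℝ (mfderiv (𝓡 2) (𝓡 7) (f ∘ j) s (d a))
    (mfderiv (𝓡 2) (𝓡 7) (f ∘ j) s (d b))

/-- The second fundamental form of `∂Y` in `Y` in the coordinate basis of `T_s ∂Y`, with respect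
to the outer normal `-n`: `(u, v) ↦ ⟪∇^⊤_u (-n), v⟫ = -⟪∇^⊤_u n, v⟫`. It is positive definite on
the boundary of a round ball. -/
def secondForm (f : Y → M) (j : S → Y) (n : (s : S) → TangentSpace (𝓡 7) ((f ∘ j) s)) (s : S) :
    Matrix (Fin 2) (Fin 2) ℝ :=
  let d : Fin 2 → TangentSpace (𝓡 2) s := fun a => EuclideanSpace.basisFun (Fin 2) ℝ a
  Matrix.of fun a b => -inner ℝ (tangentialDeriv nabla f j n s (d a))
    (mfderiv (𝓡 2) (𝓡 7) (f ∘ j) s (d b))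

/-- The mean curvature of `∂Y` in `Y`, `H = ½ tr(I⁻¹ II)`, i.e. the half sum of the principal
curvatures. -/
def meanCurvature (f : Y → M) (j : S → Y) (n : (s : S) → TangentSpace (𝓡 7) ((f ∘ j) s))
    (s : S) : ℝ :=
  ((firstForm f j s)⁻¹ * secondForm nabla f j n s).trace / 2

/-- The expression `π_L (v × ∇^⊥_w ξ - w × ∇^⊥_v ξ)` at `s`. -/
def boundaryOperator (Φ : (x : M) → TangentSpace (𝓡 7) x [⋀^Fin 3]→ₗ[ℝ] ℝ)
    (f : Y → M) (j : S → Y) (L : (s : S) → Submodule ℝ (TangentSpace (𝓡 7) ((f ∘ j) s)))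
    (ξ : (s : S) → TangentSpace (𝓡 7) ((f ∘ j) s)) (s : S) (v w : TangentSpace (𝓡 2) s) :
    TangentSpace (𝓡 7) ((f ∘ j) s) :=
  (L s).starProjection
    (cross (Φ ((f ∘ j) s)) (mfderiv (𝓡 2) (𝓡 7) (f ∘ j) s v) (normalDeriv nabla f j ξ s w)
      - cross (Φ ((f ∘ j) s)) (mfderiv (𝓡 2) (𝓡 7) (f ∘ j) s w) (normalDeriv nabla f j ξ s v))

end Boundary

end

end AssociativeBoundary

/-!
Write `F = f ∘ j` for the boundary surface in `M`, `D` for the pull-back of the Levi-Civita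
connection along `F`, and `V`, `W` for tangent fields of the surface. The operator is studied
through its pairing with vectors `l` of `L`. Since `Y` is associative, `v × l` is normal to `Y`
whenever `v` is tangent to `∂Y` and `l` is normal to `Y`; hence both projections drop out of the
pairing, and `⟪𝒟_L ξ, l⟫ = Φ(w, l, D_v ξ) - Φ(v, l, D_w ξ)` (`inner_boundaryOperator`,
`boundaryForm`). This expression is alternating in `(v, w)`, hence a multiple of the area form
`Φ(n, v, w)`, which is `1` on oriented orthonormal frames; so it does not depend on the frame
(`IsComplexPlaneBundle.boundaryForm_eq`).

The main point is that `Φ(V, χ, φ) = 0` for sections `χ`, `φ` of `L`: the plane `L` is stable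
under the complex structure `n ×`, so `χ × φ` is a multiple of `n`
(`IsG2Form.form_eq_zero_of_mem_plane`). As `Φ` is parallel, this identity may be differentiated
(`IsComplexPlaneBundle.form_covAlong_add_eq_zero`).

* Differentiating `Φ(W, χ, φ) = 0` along `v` and `Φ(V, χ, φ) = 0` along `w`, for commuting `V` and
  `W`, and using `D_v W = D_w V` (`covAlong_mfderiv_comm`), one finds that the pairing of `𝒟_L φ`
  with `χ` is symmetric in `φ` and `χ` (`IsComplexPlaneBundle.boundaryForm_comm`). The pairing
  depends on `χ` only through its value at the point, so by symmetry the same holds for `φ`: the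
  operator is of order zero and given by symmetric endomorphisms
  (`IsComplexPlaneBundle.exists_endomorphism`).
* In an orthonormal basis `φ`, `χ = n × φ` of `L` one has `v × χ = w × φ` and `w × χ = -v × φ`.
  Differentiating `Φ(V, φ, χ) = 0` along `v` and `Φ(W, φ, χ) = 0` along `w`, all derivatives of
  `φ` and `χ` cancel in the trace, and what remains is
  `Φ(D_v V + D_w W, φ, n × φ) = ⟪D_v V + D_w W, n⟫`, the trace of the second fundamental form
  (`IsComplexPlaneBundle.boundaryForm_add_boundaryForm`, `two_mul_meanCurvature`).

Smoothness of the image of a section follows by expressing its components in a local frame of `L`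
through the boundary form and the area form of coordinate fields
(`IsComplexPlaneBundle.smoothAlongAt_of_inner_eq`).
-/

namespace AssociativeBoundary

noncomputable section

/-! ### The vector product of a `G₂`-form -/

section CrossAlgebra

variable {V : Type*} [NormedAddCommGroup V] [InnerProductSpace ℝ V]

theorem form_swap_left (Φ : V [⋀^Fin 3]→ₗ[ℝ] ℝ) (u v w : V) :
    Φ ![v, u, w] = -Φ ![u, v, w] := by
  have h := Φ.map_swap ![u, v, w] (i := 0) (j := 1) (by decide)
  rw [← h]
  congr 1
  funext i
  fin_cases i <;> rfl

theorem form_swap_right (Φ : V [⋀^Fin 3]→ₗ[ℝ] ℝ) (u v w : V) :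
    Φ ![u, w, v] = -Φ ![u, v, w] := by
  have h := Φ.map_swap ![u, v, w] (i := 1) (j := 2) (by decide)
  rw [← h]
  congr 1
  funext i
  fin_cases i <;> rfl

theorem form_rotate (Φ : V [⋀^Fin 3]→ₗ[ℝ] ℝ) (u v w : V) :
    Φ ![v, w, u] = Φ ![u, v, w] := by
  rw [form_swap_right, form_swap_left, neg_neg]

theorem form_add_left (Φ : V [⋀^Fin 3]→ₗ[ℝ] ℝ) (u u' v w : V) :
    Φ ![u + u', v, w] = Φ ![u, v, w] + Φ ![u', v, w] :=
  Φ.map_vecCons_add ![v, w] u u'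

theorem form_smul_left (Φ : V [⋀^Fin 3]→ₗ[ℝ] ℝ) (c : ℝ) (u v w : V) :
    Φ ![c • u, v, w] = c * Φ ![u, v, w] :=
  Φ.map_vecCons_smul ![v, w] c u

/-- A three-form as a trilinear map. -/
def trilinear (Φ : V [⋀^Fin 3]→ₗ[ℝ] ℝ) : V →ₗ[ℝ] V →ₗ[ℝ] V →ₗ[ℝ] ℝ :=
  LinearMap.mk₂ ℝ
    (fun u v ↦
      { toFun := fun w ↦ Φ ![u, v, w]
        map_add' := fun w w' ↦ by simp only [form_rotate Φ _ u v, form_add_left]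
        map_smul' := fun c w ↦ by
          simp only [form_rotate Φ _ u v, form_smul_left, RingHom.id_apply, smul_eq_mul] })
    (fun u u' v ↦ LinearMap.ext fun w ↦ form_add_left Φ u u' v w)
    (fun c u v ↦ LinearMap.ext fun w ↦ form_smul_left Φ c u v w)
    (fun u v v' ↦ LinearMap.ext fun w ↦ by
      change Φ ![u, v + v', w] = Φ ![u, v, w] + Φ ![u, v', w]
      simp only [form_swap_left Φ _ u w, form_add_left, neg_add])
    (fun c u v ↦ LinearMap.ext fun w ↦ by
      change Φ ![u, c • v, w] = c * Φ ![u, v, w]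
      simp only [form_swap_left Φ _ u w, form_smul_left, mul_neg])

theorem trilinear_apply (Φ : V [⋀^Fin 3]→ₗ[ℝ] ℝ) (u v w : V) :
    trilinear Φ u v w = Φ ![u, v, w] := rfl

variable [FiniteDimensional ℝ V]

theorem cross_swap (Φ : V [⋀^Fin 3]→ₗ[ℝ] ℝ) (u v : V) : cross Φ v u = -cross Φ u v := by
  refine ext_inner_right ℝ fun x ↦ ?_
  rw [inner_neg_left, inner_cross, inner_cross, form_swap_left]

/-- The Lagrange identity of the vector product, with one repeated factor. In the model it is a
polynomial identity in the coordinates. -/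
theorem IsG2Form.inner_cross_cross_same {Φ : V [⋀^Fin 3]→ₗ[ℝ] ℝ} (hΦ : IsG2Form Φ)
    (u v x : V) :
    inner ℝ (cross Φ u x) (cross Φ v x) =
      inner ℝ u v * inner ℝ x x - inner ℝ u x * inner ℝ v x := by
  obtain ⟨b, hb⟩ := hΦ
  have key : ∀ y z : V, inner ℝ y z = ∑ i, b.repr y i * b.repr z i := by
    intro y z
    rw [← b.repr.inner_map_map y z, PiLp.inner_apply]
    exact Finset.sum_congr rfl fun i _ ↦ by simp [mul_comm]
  have hc : ∀ y z : V, ∀ i, b.repr (cross Φ y z) i =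
      modelForm (b.repr y) (b.repr z) (EuclideanSpace.single i 1) := by
    intro y z i
    rw [b.repr_apply_apply, real_inner_comm, inner_cross, hb, b.repr_self]
  simp only [key, hc, Fin.sum_univ_seven]
  simp only [modelForm, wedge, Matrix.det_fin_three]
  simp
  ring

/-- The polarization in `x` of `IsG2Form.inner_cross_cross_same`. -/
theorem IsG2Form.inner_cross_cross_add {Φ : V [⋀^Fin 3]→ₗ[ℝ] ℝ} (hΦ : IsG2Form Φ)
    (u v x y : V) :
    inner ℝ (cross Φ u x) (cross Φ v y) + inner ℝ (cross Φ u y) (cross Φ v x) =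
      2 * (inner ℝ u v * inner ℝ x y) - inner ℝ u x * inner ℝ v y
        - inner ℝ u y * inner ℝ v x := by
  have hadd : ∀ u, cross Φ u (x + y) = cross Φ u x + cross Φ u y := by
    intro u
    refine ext_inner_right ℝ fun z ↦ ?_
    simp only [inner_add_left, inner_cross, ← trilinear_apply, map_add, LinearMap.add_apply]
  have h := hΦ.inner_cross_cross_same u v (x + y)
  have hx := hΦ.inner_cross_cross_same u v x
  have hy := hΦ.inner_cross_cross_same u v y
  simp only [hadd, inner_add_left, inner_add_right, real_inner_comm x y] at h
  linarith

/-- The double vector product `x × (u × x) = |x|² u - ⟪u, x⟫ x`. -/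
theorem IsG2Form.cross_cross_same {Φ : V [⋀^Fin 3]→ₗ[ℝ] ℝ} (hΦ : IsG2Form Φ) (u x : V) :
    cross Φ x (cross Φ u x) = inner ℝ x x • u - inner ℝ u x • x := by
  refine ext_inner_right ℝ fun z ↦ ?_
  rw [inner_cross, form_rotate Φ z x, ← inner_cross, hΦ.inner_cross_cross_same,
    inner_sub_left, real_inner_smul_left, real_inner_smul_left, real_inner_comm z u,
    real_inner_comm z x]
  ring

/-- For pairwise orthogonal vectors the triple product is alternating; in particular
`(n × v) × l = v × (n × l)`. -/
theorem IsG2Form.cross_cross_of_orthogonal {Φ : V [⋀^Fin 3]→ₗ[ℝ] ℝ} (hΦ : IsG2Form Φ)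
    {n v l : V} (hnv : inner ℝ n v = 0) (hnl : inner ℝ n l = 0) (hvl : inner ℝ v l = 0) :
    cross Φ (cross Φ n v) l = cross Φ v (cross Φ n l) := by
  refine ext_inner_right ℝ fun x ↦ ?_
  have h := hΦ.inner_cross_cross_add x n l v
  rw [hnv, hnl, real_inner_comm v l, hvl] at h
  rw [inner_cross, inner_cross, form_rotate Φ x v, ← form_rotate Φ (cross Φ n v) l x,
    ← inner_cross, ← inner_cross, cross_swap Φ x l, inner_neg_left]
  linarith

end CrossAlgebra

/-! ### Planes in a Euclidean space and bilinear forms on a plane -/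

section PlaneAlgebra

variable {V : Type*} [NormedAddCommGroup V] [InnerProductSpace ℝ V]

theorem exists_orthonormalBasis_plane {L : Submodule ℝ V} (hL : Module.finrank ℝ L = 2)
    {a b : V} (ha : a ∈ L) (hb : b ∈ L) (haa : inner ℝ a a = 1) (hbb : inner ℝ b b = 1)
    (hab : inner ℝ a b = 0) :
    ∃ B : OrthonormalBasis (Fin 2) ℝ L, (B 0 : V) = a ∧ (B 1 : V) = b := by
  have : FiniteDimensional ℝ L := Module.finite_of_finrank_pos (by omega)
  have ho : Orthonormal ℝ (![⟨a, ha⟩, ⟨b, hb⟩] : Fin 2 → L) := by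
    rw [orthonormal_iff_ite]
    intro i k
    have hba : inner ℝ b a = 0 := by rw [real_inner_comm, hab]
    fin_cases i <;> fin_cases k <;>
      simp only [Submodule.coe_inner, Fin.zero_eta, Fin.mk_one, Matrix.cons_val_zero,
        Matrix.cons_val_one, haa, hbb, hab, hba, if_true, Fin.isValue, zero_ne_one, one_ne_zero,
        if_false]
  have ho' : Orthonormal ℝ (Set.univ.domRestrict (![⟨a, ha⟩, ⟨b, hb⟩] : Fin 2 → L)) :=
    ho.comp _ Subtype.val_injective
  obtain ⟨B, hB⟩ := ho'.exists_orthonormalBasis_extension_of_card_eq (by simpa using hL)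
  exact ⟨B, by rw [hB 0 trivial]; rfl, by rw [hB 1 trivial]; rfl⟩

/-- Coordinates in a plane with respect to a basis with non-zero Gram determinant. -/
theorem eq_of_gram_ne_zero {L : Submodule ℝ V} (hL : Module.finrank ℝ L = 2) {a b x : V}
    (ha : a ∈ L) (hb : b ∈ L) (hx : x ∈ L)
    (hdet : inner ℝ a a * inner ℝ b b - inner ℝ a b * inner ℝ a b ≠ 0) :
    x = ((inner ℝ b b * inner ℝ x a - inner ℝ a b * inner ℝ x b) *
          (inner ℝ a a * inner ℝ b b - inner ℝ a b * inner ℝ a b)⁻¹) • a +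
        ((inner ℝ a a * inner ℝ x b - inner ℝ a b * inner ℝ x a) *
          (inner ℝ a a * inner ℝ b b - inner ℝ a b * inner ℝ a b)⁻¹) • b := by
  have : FiniteDimensional ℝ L := Module.finite_of_finrank_pos (by omega)
  have hli : LinearIndependent ℝ ![a, b] := by
    rw [LinearIndependent.pair_iff]
    intro c d h
    have h1 : c * inner ℝ a a + d * inner ℝ a b = 0 := by
      have := congrArg (inner ℝ a) h
      simpa [inner_add_right, real_inner_smul_right] using this
    have h2 : c * inner ℝ a b + d * inner ℝ b b = 0 := by
      have := congrArg (inner ℝ b) h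
      simpa [inner_add_right, real_inner_smul_right, real_inner_comm a b] using this
    constructor
    · refine (mul_eq_zero.1 ?_).resolve_right hdet
      linear_combination inner ℝ b b * h1 - inner ℝ a b * h2
    · refine (mul_eq_zero.1 ?_).resolve_right hdet
      linear_combination inner ℝ a a * h2 - inner ℝ a b * h1
  have hspan : Submodule.span ℝ {a, b} = L := by
    refine Submodule.eq_of_le_of_finrank_eq
      (Submodule.span_le.2 (Set.insert_subset ha (Set.singleton_subset_iff.2 hb))) ?_
    have := finrank_span_eq_card hli
    rw [Matrix.range_cons_cons_empty] at this
    simpa [hL] using this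
  rw [← hspan] at hx
  obtain ⟨c, d, rfl⟩ := Submodule.mem_span_pair.1 hx
  simp only [inner_add_left, real_inner_smul_left, real_inner_comm a b]
  congr 2
  · rw [eq_mul_inv_iff_mul_eq₀ hdet]
    ring
  · rw [eq_mul_inv_iff_mul_eq₀ hdet]
    ring

/-- A family of functionals `b x`, labelled by objects `x` with values `ev x`, which is symmetric in
the sense that `b x (ev y) = b y (ev x)`, is represented by an endomorphism of `L`: if the objects
`σᵢ` have as values an orthonormal basis `eᵢ` of `L`, it is `k ↦ ∑ᵢ b σᵢ k • eᵢ`. -/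
theorem exists_endomorphism_of_symm (L : Submodule ℝ V) [FiniteDimensional ℝ L] {X : Type*}
    {P : X → Prop} {ev : X → V} (b : X → V →ₗ[ℝ] ℝ)
    (hsymm : ∀ x y, P x → P y → b x (ev y) = b y (ev x))
    (hex : ∀ l ∈ L, ∃ x, P x ∧ ev x = l) :
    ∃ A : L →ₗ[ℝ] L, ∀ x, P x → ∀ k : L, (k : V) = ev x → ∀ l ∈ L,
      inner ℝ (A k : V) l = b x l := by
  let B := stdOrthonormalBasis ℝ L
  choose σ hσ hσs using fun i ↦ hex (B i) (B i).2
  refine ⟨∑ i, ((b (σ i)).comp L.subtype).smulRight (B i), fun x hx k hk l hl ↦ ?_⟩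
  have hcomm : ∀ i, b (σ i) k = b x (B i) := fun i ↦ by
    rw [hk, hsymm _ _ (hσ i) hx, hσs]
  have hl' : l = ∑ i, inner ℝ (B i : V) l • (B i : V) := by
    have := congrArg L.subtype (B.sum_repr' ⟨l, hl⟩)
    simp only [map_sum, map_smul, Submodule.subtype_apply, Submodule.coe_inner] at this
    exact this.symm
  conv_rhs => rw [hl', map_sum]
  simp only [LinearMap.sum_apply, LinearMap.smulRight_apply, LinearMap.comp_apply,
    Submodule.subtype_apply, Submodule.coe_sum, Submodule.coe_smul, sum_inner,
    real_inner_smul_left, map_smul, smul_eq_mul, hcomm, mul_comm]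

theorem form_eq_zero_of_eq (Φ : V [⋀^Fin 3]→ₗ[ℝ] ℝ) (u v : V) : Φ ![u, v, v] = 0 := by
  have := form_swap_right Φ u v v
  linarith

variable [FiniteDimensional ℝ V] {Φ : V [⋀^Fin 3]→ₗ[ℝ] ℝ}

theorem inner_cross_self_right (Φ : V [⋀^Fin 3]→ₗ[ℝ] ℝ) (u v : V) :
    inner ℝ (cross Φ u v) v = 0 := by
  rw [inner_cross, form_eq_zero_of_eq]

theorem inner_cross_self_left (Φ : V [⋀^Fin 3]→ₗ[ℝ] ℝ) (u v : V) :
    inner ℝ (cross Φ u v) u = 0 := by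
  rw [inner_cross, ← form_rotate, form_eq_zero_of_eq]

theorem IsG2Form.inner_cross_cross_self (hΦ : IsG2Form Φ) {n v : V} (hn : inner ℝ n n = 1)
    (hnv : inner ℝ n v = 0) :
    inner ℝ (cross Φ n v) (cross Φ n v) = inner ℝ v v := by
  rw [hΦ.inner_cross_cross_same, hn, hnv]
  ring

/-- `n × (n × v) = -v` for a unit vector `n` orthogonal to `v`. -/
theorem IsG2Form.cross_cross_self (hΦ : IsG2Form Φ) {n v : V} (hn : inner ℝ n n = 1)
    (hnv : inner ℝ n v = 0) : cross Φ n (cross Φ n v) = -v := by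
  rw [cross_swap Φ v n]
  have h := hΦ.cross_cross_same v n
  rw [hn, real_inner_comm, hnv] at h
  have h2 : cross Φ n (-cross Φ v n) = -cross Φ n (cross Φ v n) := by
    refine ext_inner_right ℝ fun x ↦ ?_
    simp only [inner_neg_left, inner_cross, ← trilinear_apply, map_neg, LinearMap.neg_apply]
  rw [h2, h]
  simp

/-- The vector product of two vectors of a plane stable under `n ×` is a multiple of `n`. -/
theorem IsG2Form.form_eq_zero_of_mem_plane (hΦ : IsG2Form Φ) {L : Submodule ℝ V}
    (hL : Module.finrank ℝ L = 2) {n u φ χ : V} (hn : inner ℝ n n = 1)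
    (hnL : ∀ l ∈ L, inner ℝ n l = 0) (hinv : ∀ l ∈ L, cross Φ n l ∈ L) (hu : inner ℝ n u = 0)
    (hχ : χ ∈ L) (hφ : φ ∈ L) : Φ ![u, χ, φ] = 0 := by
  rcases eq_or_ne φ 0 with rfl | h0
  · exact map_zero (trilinear Φ u χ)
  have hpos : inner ℝ φ φ ≠ 0 := inner_self_ne_zero.2 h0
  have hpp := hΦ.inner_cross_cross_self hn (hnL φ hφ)
  have hp : inner ℝ φ (cross Φ n φ) = 0 := by
    rw [real_inner_comm, inner_cross_self_right]
  have hdet : inner ℝ φ φ * inner ℝ (cross Φ n φ) (cross Φ n φ)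
      - inner ℝ φ (cross Φ n φ) * inner ℝ φ (cross Φ n φ) ≠ 0 := by
    rw [hpp, hp]
    simpa using h0
  rw [eq_of_gram_ne_zero hL hφ (hinv φ hφ) hχ hdet]
  simp only [← trilinear_apply, map_add, map_smul, LinearMap.add_apply, LinearMap.smul_apply]
  have h2 : trilinear Φ u (cross Φ n φ) φ = 0 := by
    rw [trilinear_apply, form_swap_right, ← form_rotate, ← inner_cross]
    have h3 : cross Φ φ (cross Φ n φ) = inner ℝ φ φ • n - inner ℝ n φ • φ :=
      hΦ.cross_cross_same n φ
    rw [h3, hnL φ hφ, inner_sub_left, real_inner_smul_left, hu]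
    simp
  rw [h2, trilinear_apply, form_eq_zero_of_eq]
  simp

end PlaneAlgebra

section Surface

theorem bilinear_eq_sum (b : EuclideanSpace ℝ (Fin 2) →ₗ[ℝ] EuclideanSpace ℝ (Fin 2) →ₗ[ℝ] ℝ)
    (v w : EuclideanSpace ℝ (Fin 2)) :
    b v w = ∑ i, ∑ k, v i * w k *
      b (EuclideanSpace.basisFun (Fin 2) ℝ i) (EuclideanSpace.basisFun (Fin 2) ℝ k) := by
  have h : ∀ x : EuclideanSpace ℝ (Fin 2), x = ∑ i, x i • EuclideanSpace.basisFun (Fin 2) ℝ i :=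
    fun x ↦ by
      conv_lhs => rw [← (EuclideanSpace.basisFun (Fin 2) ℝ).sum_repr x]
      simp only [EuclideanSpace.basisFun_repr]
  conv_lhs => rw [h v, map_sum, LinearMap.sum_apply]
  refine Finset.sum_congr rfl fun i _ ↦ ?_
  conv_lhs => rw [h w, map_sum]
  refine Finset.sum_congr rfl fun k _ ↦ ?_
  simp only [map_smul, LinearMap.smul_apply, smul_eq_mul]
  ring

theorem alternating_eq_det_mul
    (b : EuclideanSpace ℝ (Fin 2) →ₗ[ℝ] EuclideanSpace ℝ (Fin 2) →ₗ[ℝ] ℝ)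
    (hb : ∀ v, b v v = 0) (v w : EuclideanSpace ℝ (Fin 2)) :
    b v w = (v 0 * w 1 - v 1 * w 0) *
      b (EuclideanSpace.basisFun (Fin 2) ℝ 0) (EuclideanSpace.basisFun (Fin 2) ℝ 1) := by
  have h01 := hb (EuclideanSpace.basisFun (Fin 2) ℝ 0 + EuclideanSpace.basisFun (Fin 2) ℝ 1)
  simp only [map_add, LinearMap.add_apply, hb] at h01
  rw [bilinear_eq_sum]
  simp only [Fin.sum_univ_two, hb]
  linear_combination v 1 * w 0 * h01

/-- Two alternating bilinear forms on a plane are proportional. -/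
theorem alternating_mul_comm
    {b c : EuclideanSpace ℝ (Fin 2) →ₗ[ℝ] EuclideanSpace ℝ (Fin 2) →ₗ[ℝ] ℝ}
    (hb : ∀ v, b v v = 0) (hc : ∀ v, c v v = 0) (v w v' w' : EuclideanSpace ℝ (Fin 2)) :
    b v w * c v' w' = b v' w' * c v w := by
  rw [alternating_eq_det_mul b hb v w, alternating_eq_det_mul b hb v' w',
    alternating_eq_det_mul c hc v w, alternating_eq_det_mul c hc v' w']
  ring

/-- The trace of a bilinear form `h` with respect to a scalar product `g`, computed in the
coordinate basis and in an orthonormal basis. -/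
theorem trace_inv_mul_eq
    (g h : EuclideanSpace ℝ (Fin 2) →ₗ[ℝ] EuclideanSpace ℝ (Fin 2) →ₗ[ℝ] ℝ)
    {v w : EuclideanSpace ℝ (Fin 2)} (hvv : g v v = 1) (hww : g w w = 1) (hvw : g v w = 0)
    (hwv : g w v = 0) :
    ((Matrix.of fun a b ↦ g (EuclideanSpace.basisFun (Fin 2) ℝ a)
        (EuclideanSpace.basisFun (Fin 2) ℝ b))⁻¹ *
      Matrix.of fun a b ↦ h (EuclideanSpace.basisFun (Fin 2) ℝ a)
        (EuclideanSpace.basisFun (Fin 2) ℝ b)).trace = h v v + h w w := by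
  set G : Matrix (Fin 2) (Fin 2) ℝ := Matrix.of fun a b ↦
    g (EuclideanSpace.basisFun (Fin 2) ℝ a) (EuclideanSpace.basisFun (Fin 2) ℝ b) with hG
  set K : Matrix (Fin 2) (Fin 2) ℝ := Matrix.of fun a b ↦
    h (EuclideanSpace.basisFun (Fin 2) ℝ a) (EuclideanSpace.basisFun (Fin 2) ℝ b) with hK
  let P : Matrix (Fin 2) (Fin 2) ℝ := !![v 0, w 0; v 1, w 1]
  have hP : P.transpose * (G * P) = 1 := by
    rw [bilinear_eq_sum] at hvv hww hvw hwv
    simp only [Fin.sum_univ_two] at hvv hww hvw hwv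
    ext i k
    fin_cases i <;> fin_cases k <;>
      simp only [Matrix.mul_apply, Fin.sum_univ_two, P, hG, Matrix.transpose_apply,
        Matrix.of_apply, Matrix.cons_val', Matrix.cons_val_zero, Matrix.cons_val_one,
        Matrix.cons_val_fin_one, Fin.zero_eta, Fin.mk_one, Matrix.one_apply_eq, ne_eq,
        Fin.isValue, zero_ne_one, one_ne_zero, not_false_eq_true, Matrix.one_apply_ne]
    · linarith
    · linarith
    · linarith
    · linarith
  have hinv : G⁻¹ = P * P.transpose := by
    refine Matrix.inv_eq_right_inv ?_
    rw [← mul_assoc]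
    exact mul_eq_one_comm.1 hP
  rw [hinv, Matrix.mul_assoc, Matrix.trace_mul_comm, bilinear_eq_sum h v, bilinear_eq_sum h w]
  simp only [Matrix.trace, Matrix.diag, Matrix.mul_apply, Fin.sum_univ_two, P, hK,
    Matrix.transpose_apply, Matrix.of_apply, Matrix.cons_val', Matrix.cons_val_zero,
    Matrix.cons_val_one, Matrix.cons_val_fin_one]
  ring

end Surface

/-! ### Vector fields along a surface in a coordinate frame -/

theorem contMDiffAt_euclidean_iff {H E S ι : Type*} [Fintype ι] [NormedAddCommGroup E]
    [NormedSpace ℝ E] [TopologicalSpace H] {I : ModelWithCorners ℝ E H} [TopologicalSpace S]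
    [ChartedSpace H S] {f : S → EuclideanSpace ℝ ι} {s : S} :
    ContMDiffAt I 𝓘(ℝ, EuclideanSpace ℝ ι) ∞ f s ↔
      ∀ i, ContMDiffAt I 𝓘(ℝ, ℝ) ∞ (fun t ↦ f t i) s := by
  constructor
  · intro h i
    exact ((EuclideanSpace.proj i : EuclideanSpace ℝ ι →L[ℝ] ℝ).contDiff.contMDiff.contMDiffAt).comp
      s h
  · intro h
    exact ((EuclideanSpace.equiv ι ℝ).symm.contDiff.contMDiff.contMDiffAt).comp s
      (contMDiffAt_pi_space.2 h)

section PullBack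

variable {M : Type*} [TopologicalSpace M] [ChartedSpace (EuclideanSpace ℝ (Fin 7)) M]
  [IsManifold (𝓡 7) ∞ M]
  {S : Type*} [TopologicalSpace S] [ChartedSpace (EuclideanSpace ℝ (Fin 2)) S]

/-- The coordinate trivialization of the tangent bundle of `M` around `p`. -/
abbrev triv (p : M) :=
  trivializationAt (EuclideanSpace ℝ (Fin 7)) (fun x : M => TangentSpace (𝓡 7) x) p

/-- The coordinate frame of the tangent bundle of `M` around `p`. -/
def coordFrame (p : M) (i : Fin 7) : (x : M) → TangentSpace (𝓡 7) x :=
  (triv p).localFrame (EuclideanSpace.basisFun (Fin 7) ℝ).toBasis i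

/-- The coefficients of tangent vectors in the coordinate frame around `p`. -/
def coordCoeff (p : M) (i : Fin 7) (x : M) : TangentSpace (𝓡 7) x →ₗ[ℝ] ℝ :=
  (triv p).localFrameCoeff (𝓡 7) (EuclideanSpace.basisFun (Fin 7) ℝ).toBasis i x

theorem covAlong_eq (nabla : CovariantDerivative (𝓡 7) (EuclideanSpace ℝ (Fin 7))
      (fun x : M => TangentSpace (𝓡 7) x))
    (F : S → M) (ξ : (s : S) → TangentSpace (𝓡 7) (F s)) (s : S) (w : TangentSpace (𝓡 2) s) :
    covAlong nabla F ξ s w =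
      ∑ i, (mvfderiv (𝓡 2) (fun t => coordCoeff (F s) i (F t) (ξ t)) s w •
          coordFrame (F s) i (F s)
        + coordCoeff (F s) i (F s) (ξ s) •
          nabla (coordFrame (F s) i) (F s) (mfderiv (𝓡 2) (𝓡 7) F s w)) := rfl

theorem mem_baseSet_triv_self (p : M) : p ∈ (triv p).baseSet :=
  FiberBundle.mem_baseSet_trivializationAt' p

theorem coordCoeff_eq {p x : M} (hx : x ∈ (triv p).baseSet) (i : Fin 7)
    (v : TangentSpace (𝓡 7) x) :
    coordCoeff p i x v = (triv p (⟨x, v⟩ : TangentBundle (𝓡 7) M)).2 i := by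
  classical
  have h := (triv p).localFrameCoeff_eq_coeff (I := 𝓡 7)
    (b := (EuclideanSpace.basisFun (Fin 7) ℝ).toBasis)
    (s := Function.update (fun _ ↦ 0) x v) hx (i := i)
  simp only [Function.update_self, OrthonormalBasis.coe_toBasis_repr_apply,
    EuclideanSpace.basisFun_repr] at h
  exact h

theorem sum_coordCoeff {p x : M} (hx : x ∈ (triv p).baseSet) (v : TangentSpace (𝓡 7) x) :
    ∑ i, coordCoeff p i x v • coordFrame p i x = v := by
  classical
  have h := (triv p).eq_sum_localFrameCoeff_smul (I := 𝓡 7)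
    (b := (EuclideanSpace.basisFun (Fin 7) ℝ).toBasis)
    (s := Function.update (fun _ ↦ 0) x v) hx
  rw [Function.update_self] at h
  exact h.symm

theorem contMDiffAt_coordFrame {p x : M} (hx : x ∈ (triv p).baseSet) (i : Fin 7) :
    ContMDiffAt (𝓡 7) (𝓡 7).tangent ∞
      (fun y ↦ (⟨y, coordFrame p i y⟩ : TangentBundle (𝓡 7) M)) x :=
  contMDiffAt_localFrame_of_mem ∞ _ _ i hx

/-- Differentiability at `s` of a vector field along `F`. -/
def DiffAlongAt (F : S → M) (ξ : (s : S) → TangentSpace (𝓡 7) (F s)) (s : S) : Prop :=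
  MDifferentiableAt (𝓡 2) (𝓡 7).tangent (fun t => (⟨F t, ξ t⟩ : TangentBundle (𝓡 7) M)) s

/-- Smoothness at `s` of a vector field along `F`. -/
def SmoothAlongAt (F : S → M) (ξ : (s : S) → TangentSpace (𝓡 7) (F s)) (s : S) : Prop :=
  ContMDiffAt (𝓡 2) (𝓡 7).tangent ∞ (fun t => (⟨F t, ξ t⟩ : TangentBundle (𝓡 7) M)) s

variable {F : S → M} {ξ η ζ : (s : S) → TangentSpace (𝓡 7) (F s)} {s : S}

theorem SmoothAlongAt.diff (h : SmoothAlongAt F ξ s) : DiffAlongAt F ξ s :=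
  ContMDiffAt.mdifferentiableAt h (by simp)

/-- A vector field along `F` is smooth if and only if `F` and the coefficients in some
coordinate frame are smooth. -/
theorem smoothAlongAt_iff {p : M} (hp : F s ∈ (triv p).baseSet) :
    SmoothAlongAt F ξ s ↔ ContMDiffAt (𝓡 2) (𝓡 7) ∞ F s ∧
      ∀ i, ContMDiffAt (𝓡 2) 𝓘(ℝ, ℝ) ∞ (fun t ↦ coordCoeff p i (F t) (ξ t)) s := by
  rw [SmoothAlongAt, (triv p).contMDiffAt_iff (IB := 𝓡 7) ((triv p).mem_source.2 hp)]
  refine and_congr_right fun hF ↦ ?_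
  have hev : ∀ᶠ t in nhds s, F t ∈ (triv p).baseSet :=
    hF.continuousAt.eventually ((triv p).open_baseSet.mem_nhds hp)
  have h1 : ∀ i, (fun t ↦ coordCoeff p i (F t) (ξ t)) =ᶠ[nhds s]
      fun t ↦ (triv p (⟨F t, ξ t⟩ : TangentBundle (𝓡 7) M)).2 i := fun i ↦
    hev.mono fun t ht ↦ coordCoeff_eq ht i (ξ t)
  have h2 : (∀ i, ContMDiffAt (𝓡 2) 𝓘(ℝ, ℝ) ∞ (fun t ↦ coordCoeff p i (F t) (ξ t)) s) ↔
      ∀ i, ContMDiffAt (𝓡 2) 𝓘(ℝ, ℝ) ∞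
        (fun t ↦ (triv p (⟨F t, ξ t⟩ : TangentBundle (𝓡 7) M)).2 i) s :=
    forall_congr' fun i ↦ (h1 i).contMDiffAt_iff
  rw [h2]
  exact contMDiffAt_euclidean_iff

theorem DiffAlongAt.mdifferentiableAt (h : DiffAlongAt F ξ s) :
    MDifferentiableAt (𝓡 2) (𝓡 7) F s :=
  ((mdifferentiableAt_totalSpace (𝓡 7) _).1 h).1

theorem DiffAlongAt.coordCoeff {p : M} (h : DiffAlongAt F ξ s) (hp : F s ∈ (triv p).baseSet)
    (i : Fin 7) :
    MDifferentiableAt (𝓡 2) 𝓘(ℝ, ℝ) (fun t ↦ coordCoeff p i (F t) (ξ t)) s := by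
  have h0 := ((triv p).mdifferentiableAt_totalSpace_iff (𝓡 7) _
    ((triv p).mem_source.2 hp)).1 h
  have hev : ∀ᶠ t in nhds s, F t ∈ (triv p).baseSet :=
    h0.1.continuousAt.eventually ((triv p).open_baseSet.mem_nhds hp)
  refine MDifferentiableAt.congr_of_eventuallyEq ?_
    (hev.mono fun t ht ↦ coordCoeff_eq ht i (ξ t))
  have hl : MDifferentiableAt 𝓘(ℝ, EuclideanSpace ℝ (Fin 7)) 𝓘(ℝ, ℝ)
      (EuclideanSpace.proj i : EuclideanSpace ℝ (Fin 7) →L[ℝ] ℝ)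
      (triv p (⟨F s, ξ s⟩ : TangentBundle (𝓡 7) M)).2 :=
    (EuclideanSpace.proj i : EuclideanSpace ℝ (Fin 7) →L[ℝ] ℝ).differentiableAt.mdifferentiableAt
  exact hl.comp s h0.2

end PullBack

/-! ### The pull-back connection -/

theorem mvfderiv_sum_apply {H E S ι : Type*} [NormedAddCommGroup E]
    [NormedSpace ℝ E] [TopologicalSpace H] {I : ModelWithCorners ℝ E H} [TopologicalSpace S]
    [ChartedSpace H S] (J : Finset ι) {g : ι → S → ℝ} {s : S}
    (hg : ∀ i ∈ J, MDifferentiableAt I 𝓘(ℝ, ℝ) (g i) s) (w : TangentSpace I s) :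
    mvfderiv I (fun t ↦ ∑ i ∈ J, g i t) s w = ∑ i ∈ J, mvfderiv I (g i) s w := by
  classical
  suffices h : MDifferentiableAt I 𝓘(ℝ, ℝ) (fun t ↦ ∑ i ∈ J, g i t) s ∧
      mvfderiv I (fun t ↦ ∑ i ∈ J, g i t) s w = ∑ i ∈ J, mvfderiv I (g i) s w from h.2
  induction J using Finset.induction_on with
  | empty => simp [mvfderiv_const, mdifferentiableAt_const]
  | insert a J ha ih =>
    obtain ⟨h1, h2⟩ := ih fun i hi ↦ hg i (Finset.mem_insert_of_mem hi)
    have h0 := hg a (Finset.mem_insert_self a J)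
    simp only [Finset.sum_insert ha]
    refine ⟨h0.add h1, ?_⟩
    rw [mvfderiv_fun_add h0 h1, add_apply, h2]

theorem mvfderiv_congr {H E S : Type*} [NormedAddCommGroup E]
    [NormedSpace ℝ E] [TopologicalSpace H] {I : ModelWithCorners ℝ E H} [TopologicalSpace S]
    [ChartedSpace H S] {g g' : S → ℝ} {s : S} (h : g =ᶠ[nhds s] g') (w : TangentSpace I s) :
    mvfderiv I g s w = mvfderiv I g' s w := by
  have h1 := h.mfderiv_eq (I := I) (I' := 𝓘(ℝ, ℝ))
  exact congrArg (fun A : TangentSpace I s →L[ℝ] ℝ ↦ A w) h1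

theorem mvfderiv_mul_apply {H E S : Type*} [NormedAddCommGroup E]
    [NormedSpace ℝ E] [TopologicalSpace H] {I : ModelWithCorners ℝ E H} [TopologicalSpace S]
    [ChartedSpace H S] {g g' : S → ℝ} {s : S}
    (hg : MDifferentiableAt I 𝓘(ℝ, ℝ) g s) (hg' : MDifferentiableAt I 𝓘(ℝ, ℝ) g' s)
    (w : TangentSpace I s) :
    mvfderiv I (fun t ↦ g t * g' t) s w = g s * mvfderiv I g' s w + mvfderiv I g s w * g' s := by
  rw [mvfderiv_fun_mul hg hg']
  simp [mul_comm]

section PullBack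

variable {M : Type*} [TopologicalSpace M] [ChartedSpace (EuclideanSpace ℝ (Fin 7)) M]
  [IsManifold (𝓡 7) ∞ M]
  {S : Type*} [TopologicalSpace S] [ChartedSpace (EuclideanSpace ℝ (Fin 2)) S]
  (nabla : CovariantDerivative (𝓡 7) (EuclideanSpace ℝ (Fin 7))
    (fun x : M => TangentSpace (𝓡 7) x))
  {F : S → M} {ξ η ζ : (s : S) → TangentSpace (𝓡 7) (F s)} {s : S}

/-- Differentiability at `x` of a vector field on `M`. -/
abbrev DiffFieldAt (X : (x : M) → TangentSpace (𝓡 7) x) (x : M) : Prop :=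
  MDifferentiableAt (𝓡 7) (𝓡 7).tangent (fun y => (⟨y, X y⟩ : TangentBundle (𝓡 7) M)) x

theorem diffFieldAt_coordFrame {p x : M} (hx : x ∈ (triv p).baseSet) (i : Fin 7) :
    DiffFieldAt (coordFrame p i) x :=
  (contMDiffAt_coordFrame hx i).mdifferentiableAt (by simp)

theorem DiffFieldAt.coordCoeff {X : (x : M) → TangentSpace (𝓡 7) x} {p x : M}
    (hX : DiffFieldAt X x) (hx : x ∈ (triv p).baseSet) (i : Fin 7) :
    MDifferentiableAt (𝓡 7) 𝓘(ℝ, ℝ) (fun y ↦ coordCoeff p i y (X y)) x :=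
  mdifferentiableAt_localFrameCoeff _ hx hX i

theorem nabla_sum {ι : Type*} (J : Finset ι) {X : ι → (x : M) → TangentSpace (𝓡 7) x} {x : M}
    (hX : ∀ i ∈ J, DiffFieldAt (X i) x) :
    nabla (fun y ↦ ∑ i ∈ J, X i y) x = ∑ i ∈ J, nabla (X i) x := by
  classical
  suffices h : DiffFieldAt (fun y ↦ ∑ i ∈ J, X i y) x ∧
      nabla (fun y ↦ ∑ i ∈ J, X i y) x = ∑ i ∈ J, nabla (X i) x from h.2
  induction J using Finset.induction_on with
  | empty =>
    simp only [Finset.sum_empty]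
    exact ⟨mdifferentiableAt_zeroSection .., congrFun nabla.zero x⟩
  | insert a J ha ih =>
    obtain ⟨h1, h2⟩ := ih fun i hi ↦ hX i (Finset.mem_insert_of_mem hi)
    have h0 := hX a (Finset.mem_insert_self a J)
    simp only [Finset.sum_insert ha]
    refine ⟨mdifferentiableAt_add_section h0 h1, ?_⟩
    rw [← h2]
    exact nabla.isCovariantDerivativeOnUniv.add h0 h1

theorem nabla_eq_sum {X : (x : M) → TangentSpace (𝓡 7) x} {p x : M}
    (hX : DiffFieldAt X x) (hx : x ∈ (triv p).baseSet) (v : TangentSpace (𝓡 7) x) :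
    nabla X x v = ∑ i, (mvfderiv (𝓡 7) (fun y ↦ coordCoeff p i y (X y)) x v • coordFrame p i x
      + coordCoeff p i x (X x) • nabla (coordFrame p i) x v) := by
  have hd : ∀ i, DiffFieldAt (fun y ↦ coordCoeff p i y (X y) • coordFrame p i y) x := fun i ↦
    (hX.coordCoeff hx i).smul_section (diffFieldAt_coordFrame hx i)
  have h1 : nabla X x = nabla (fun y ↦ ∑ i, coordCoeff p i y (X y) • coordFrame p i y) x := by
    refine nabla.isCovariantDerivativeOnUniv.congr_of_eventuallyEq hX ?_ Filter.univ_mem ?_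
    · exact MDifferentiableAt.sum_section fun i _ ↦ hd i
    · filter_upwards [(triv p).open_baseSet.mem_nhds hx] with y hy
      exact (sum_coordCoeff hy (X y)).symm
  rw [h1, nabla_sum nabla _ fun i _ ↦ hd i, sum_apply]
  refine Finset.sum_congr rfl fun i _ ↦ ?_
  have h2 := nabla.isCovariantDerivativeOnUniv.leibniz (diffFieldAt_coordFrame hx i)
    (hX.coordCoeff hx i)
  have h3 := congrArg (fun A : TangentSpace (𝓡 7) x →L[ℝ] TangentSpace (𝓡 7) x ↦ A v) h2
  refine h3.trans ?_
  simp [add_comm]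

theorem covAlong_congr (h : ∀ᶠ t in nhds s, ξ t = η t) (w : TangentSpace (𝓡 2) s) :
    covAlong nabla F ξ s w = covAlong nabla F η s w := by
  rw [covAlong_eq, covAlong_eq]
  refine Finset.sum_congr rfl fun i _ ↦ ?_
  rw [mvfderiv_congr (g' := fun t ↦ coordCoeff (F s) i (F t) (η t))
    (h.mono fun t ht ↦ by simp only [ht]), h.self_of_nhds]

theorem covAlong_sum {ι : Type*} (J : Finset ι) {ξ : ι → (s : S) → TangentSpace (𝓡 7) (F s)}
    (hξ : ∀ j ∈ J, ∀ i, MDifferentiableAt (𝓡 2) 𝓘(ℝ, ℝ)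
      (fun t ↦ coordCoeff (F s) i (F t) (ξ j t)) s) (w : TangentSpace (𝓡 2) s) :
    covAlong nabla F (fun t ↦ ∑ j ∈ J, ξ j t) s w = ∑ j ∈ J, covAlong nabla F (ξ j) s w := by
  simp only [covAlong_eq]
  rw [Finset.sum_comm]
  refine Finset.sum_congr rfl fun i _ ↦ ?_
  simp only [map_sum]
  rw [mvfderiv_sum_apply J fun j hj ↦ hξ j hj i,
    Finset.sum_add_distrib, Finset.sum_smul, Finset.sum_smul]

/-- The Leibniz and chain rules for the pull-back connection. -/
theorem covAlong_smul_comp {g : S → ℝ} {X : (x : M) → TangentSpace (𝓡 7) x}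
    (hF : MDifferentiableAt (𝓡 2) (𝓡 7) F s) (hg : MDifferentiableAt (𝓡 2) 𝓘(ℝ, ℝ) g s)
    (hX : DiffFieldAt X (F s)) (w : TangentSpace (𝓡 2) s) :
    covAlong nabla F (fun t ↦ g t • X (F t)) s w =
      mvfderiv (𝓡 2) g s w • X (F s)
        + g s • nabla X (F s) (mfderiv (𝓡 2) (𝓡 7) F s w) := by
  have hp := mem_baseSet_triv_self (F s)
  have hsum : mvfderiv (𝓡 2) g s w • X (F s) = ∑ i, mvfderiv (𝓡 2) g s w •
      coordCoeff (F s) i (F s) (X (F s)) • coordFrame (F s) i (F s) := by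
    rw [← Finset.smul_sum, sum_coordCoeff hp]
  rw [covAlong_eq, nabla_eq_sum nabla hX hp, Finset.smul_sum, hsum, ← Finset.sum_add_distrib]
  refine Finset.sum_congr rfl fun i _ ↦ ?_
  have hc := hX.coordCoeff hp i
  simp only [map_smul, smul_eq_mul]
  have h1 := mvfderiv_mul_apply hg (hc.comp s hF) w
  have h2 := mvfderiv_comp_apply s hc hF w
  simp only [Function.comp_def] at h1 h2
  rw [h1, h2]
  module

theorem eventually_eq_sum_coordFrame (hF : MDifferentiableAt (𝓡 2) (𝓡 7) F s)
    (ξ : (s : S) → TangentSpace (𝓡 7) (F s)) :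
    ∀ᶠ t in nhds s, ξ t = ∑ i, coordCoeff (F s) i (F t) (ξ t) • coordFrame (F s) i (F t) :=
  (hF.continuousAt.eventually ((triv (F s)).open_baseSet.mem_nhds
    (mem_baseSet_triv_self (F s)))).mono fun t ht ↦ (sum_coordCoeff ht (ξ t)).symm

/-- The pull-back connection may be computed in any coordinate frame. -/
theorem covAlong_eq_sum {p : M} (hξ : DiffAlongAt F ξ s) (hp : F s ∈ (triv p).baseSet)
    (w : TangentSpace (𝓡 2) s) :
    covAlong nabla F ξ s w =
      ∑ i, (mvfderiv (𝓡 2) (fun t => coordCoeff p i (F t) (ξ t)) s w • coordFrame p i (F s)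
        + coordCoeff p i (F s) (ξ s) •
          nabla (coordFrame p i) (F s) (mfderiv (𝓡 2) (𝓡 7) F s w)) := by
  have hF := hξ.mdifferentiableAt
  have hev : ∀ᶠ t in nhds s, ξ t = ∑ i, coordCoeff p i (F t) (ξ t) • coordFrame p i (F t) :=
    (hF.continuousAt.eventually ((triv p).open_baseSet.mem_nhds hp)).mono fun t ht ↦
      (sum_coordCoeff ht (ξ t)).symm
  rw [covAlong_congr nabla hev, covAlong_sum]
  · exact Finset.sum_congr rfl fun i _ ↦
      covAlong_smul_comp nabla hF (hξ.coordCoeff hp i) (diffFieldAt_coordFrame hp i) w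
  · intro j _ i
    simp only [map_smul]
    exact (hξ.coordCoeff hp j).mul
      (((diffFieldAt_coordFrame hp j).coordCoeff (mem_baseSet_triv_self (F s)) i).comp s hF)

end PullBack

/-! ### Parallel metric and parallel three-form along a surface -/

section FormAlong

variable {M : Type*} [TopologicalSpace M] [ChartedSpace (EuclideanSpace ℝ (Fin 7)) M]
  [RiemannianBundle (fun x : M => TangentSpace (𝓡 7) x)]
  {S : Type*} [TopologicalSpace S] [ChartedSpace (EuclideanSpace ℝ (Fin 2)) S]
  {F : S → M} {s : S}

theorem form_sum {x : M} (Φ : TangentSpace (𝓡 7) x [⋀^Fin 3]→ₗ[ℝ] ℝ)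
    (A B C : Fin 7 → TangentSpace (𝓡 7) x) :
    Φ ![∑ i, A i, ∑ j, B j, ∑ k, C k] =
      ∑ k : Fin 7 × Fin 7 × Fin 7, Φ ![A k.1, B k.2.1, C k.2.2] := by
  simp only [← trilinear_apply]
  simp_rw [Fintype.sum_prod_type]
  rw [map_sum (trilinear Φ), LinearMap.sum_apply, LinearMap.sum_apply]
  refine Finset.sum_congr rfl fun i _ ↦ ?_
  rw [map_sum (trilinear Φ (A i)), LinearMap.sum_apply]
  exact Finset.sum_congr rfl fun j _ ↦ map_sum _ _ _

theorem eventually_form_eq_sum [IsManifold (𝓡 7) ∞ M]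
    (Φ : (x : M) → TangentSpace (𝓡 7) x [⋀^Fin 3]→ₗ[ℝ] ℝ)
    (hF : MDifferentiableAt (𝓡 2) (𝓡 7) F s) (ξ η ζ : (s : S) → TangentSpace (𝓡 7) (F s)) :
    (fun t ↦ Φ (F t) ![ξ t, η t, ζ t]) =ᶠ[nhds s]
      fun t ↦ ∑ k : Fin 7 × Fin 7 × Fin 7,
        ((coordCoeff (F s) k.1 (F t) (ξ t) * coordCoeff (F s) k.2.1 (F t) (η t)) *
          coordCoeff (F s) k.2.2 (F t) (ζ t)) *
        Φ (F t) ![coordFrame (F s) k.1 (F t), coordFrame (F s) k.2.1 (F t),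
          coordFrame (F s) k.2.2 (F t)] := by
  filter_upwards [eventually_eq_sum_coordFrame hF ξ, eventually_eq_sum_coordFrame hF η,
    eventually_eq_sum_coordFrame hF ζ] with t h1 h2 h3
  conv_lhs => rw [h1, h2, h3]
  rw [form_sum]
  refine Finset.sum_congr rfl fun k _ ↦ ?_
  simp only [← trilinear_apply, map_smul, LinearMap.smul_apply, smul_eq_mul]
  ring

end FormAlong

section Parallel

variable {M : Type*} [TopologicalSpace M] [ChartedSpace (EuclideanSpace ℝ (Fin 7)) M]
  [IsManifold (𝓡 7) ∞ M] [RiemannianBundle (fun x : M => TangentSpace (𝓡 7) x)]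
  {S : Type*} [TopologicalSpace S] [ChartedSpace (EuclideanSpace ℝ (Fin 2)) S]
  {nabla : CovariantDerivative (𝓡 7) (EuclideanSpace ℝ (Fin 7))
    (fun x : M => TangentSpace (𝓡 7) x)}
  {F : S → M} {ξ η ζ : (s : S) → TangentSpace (𝓡 7) (F s)} {s : S}

/-- The pull-back of a metric connection is metric. -/
theorem mvfderiv_inner_along [IsContMDiffRiemannianBundle (𝓡 7) ∞ (EuclideanSpace ℝ (Fin 7))
      (fun x : M => TangentSpace (𝓡 7) x)]
    (hnabla : nabla.IsMetricCompatible) (hξ : DiffAlongAt F ξ s)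
    (hη : DiffAlongAt F η s) (w : TangentSpace (𝓡 2) s) :
    mvfderiv (𝓡 2) (fun t ↦ inner ℝ (ξ t) (η t)) s w =
      inner ℝ (covAlong nabla F ξ s w) (η s) + inner ℝ (ξ s) (covAlong nabla F η s w) := by
  classical
  have hp := mem_baseSet_triv_self (F s)
  have hF := hξ.mdifferentiableAt
  have hE := fun i ↦ diffFieldAt_coordFrame hp i
  have expand : ∀ {x : M} (A B : Fin 7 → TangentSpace (𝓡 7) x),
      inner ℝ (∑ i, A i) (∑ j, B j) = ∑ k : Fin 7 × Fin 7, inner ℝ (A k.1) (B k.2) := by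
    intro x A B
    rw [sum_inner, Fintype.sum_prod_type]
    exact Finset.sum_congr rfl fun i _ ↦ inner_sum _ _ _
  have hg : ∀ i j, MDifferentiableAt (𝓡 7) 𝓘(ℝ, ℝ)
      (fun y ↦ inner ℝ (coordFrame (F s) i y) (coordFrame (F s) j y)) (F s) := fun i j ↦
    MDifferentiableAt.inner_bundle (hE i) (hE j)
  have hc := fun i ↦ hξ.coordCoeff hp i
  have hd := fun i ↦ hη.coordCoeff hp i
  have hev : (fun t ↦ inner ℝ (ξ t) (η t)) =ᶠ[nhds s] fun t ↦ ∑ k : Fin 7 × Fin 7,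
      (coordCoeff (F s) k.1 (F t) (ξ t) * coordCoeff (F s) k.2 (F t) (η t)) *
        inner ℝ (coordFrame (F s) k.1 (F t)) (coordFrame (F s) k.2 (F t)) := by
    filter_upwards [eventually_eq_sum_coordFrame hF ξ, eventually_eq_sum_coordFrame hF η]
      with t h1 h2
    conv_lhs => rw [h1, h2]
    rw [expand]
    refine Finset.sum_congr rfl fun k _ ↦ ?_
    rw [real_inner_smul_left, real_inner_smul_right, mul_assoc]
  rw [mvfderiv_congr hev, mvfderiv_sum_apply _ fun k _ ↦
    ((hc k.1).mul (hd k.2)).mul ((hg k.1 k.2).comp s hF)]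
  conv_rhs => rw [(eventually_eq_sum_coordFrame hF ξ).self_of_nhds,
    (eventually_eq_sum_coordFrame hF η).self_of_nhds]
  rw [covAlong_eq, covAlong_eq, expand, expand, ← Finset.sum_add_distrib]
  refine Finset.sum_congr rfl fun k _ ↦ ?_
  obtain ⟨i, j⟩ := k
  have h1 := mvfderiv_mul_apply ((hc i).mul (hd j)) ((hg i j).comp s hF) w
  have h2 := mvfderiv_mul_apply (hc i) (hd j) w
  have h3 := mvfderiv_comp_apply s (hg i j) hF w
  have h4 := hnabla.mvfderiv_inner_eq
    (Function.update (fun _ ↦ 0) (F s) (mfderiv (𝓡 2) (𝓡 7) F s w)) (hE i) (hE j)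
  simp only [Function.comp_def, Function.update_self, Pi.mul_def] at h1 h2 h3 h4
  dsimp only
  rw [h1, h2, h3, h4]
  simp only [inner_add_left, inner_add_right, real_inner_smul_left, real_inner_smul_right]
  ring

/-- The pull-back connection preserves a parallel three-form. -/
theorem mvfderiv_form_along {Φ : (x : M) → TangentSpace (𝓡 7) x [⋀^Fin 3]→ₗ[ℝ] ℝ}
    (hΦ : IsTorsionFreeG2Structure nabla Φ) (hξ : DiffAlongAt F ξ s)
    (hη : DiffAlongAt F η s) (hζ : DiffAlongAt F ζ s) (w : TangentSpace (𝓡 2) s) :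
    mvfderiv (𝓡 2) (fun t ↦ Φ (F t) ![ξ t, η t, ζ t]) s w =
      Φ (F s) ![covAlong nabla F ξ s w, η s, ζ s] + Φ (F s) ![ξ s, covAlong nabla F η s w, ζ s]
        + Φ (F s) ![ξ s, η s, covAlong nabla F ζ s w] := by
  have hp := mem_baseSet_triv_self (F s)
  have hF := hξ.mdifferentiableAt
  have hE := fun i ↦ diffFieldAt_coordFrame hp i
  have hg : ∀ i j k, MDifferentiableAt (𝓡 7) 𝓘(ℝ, ℝ)
      (fun y ↦ Φ y ![coordFrame (F s) i y, coordFrame (F s) j y, coordFrame (F s) k y]) (F s) :=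
    fun i j k ↦ (hΦ.smooth _ _ _ _ (contMDiffAt_coordFrame hp i) (contMDiffAt_coordFrame hp j)
      (contMDiffAt_coordFrame hp k)).mdifferentiableAt (by simp)
  have hc := fun i ↦ hξ.coordCoeff hp i
  have hd := fun i ↦ hη.coordCoeff hp i
  have he := fun i ↦ hζ.coordCoeff hp i
  have hev := eventually_form_eq_sum Φ hF ξ η ζ
  rw [mvfderiv_congr hev, mvfderiv_sum_apply _ fun k _ ↦
    (((hc k.1).mul (hd k.2.1)).mul (he k.2.2)).mul ((hg k.1 k.2.1 k.2.2).comp s hF)]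
  conv_rhs => rw [(eventually_eq_sum_coordFrame hF ξ).self_of_nhds,
    (eventually_eq_sum_coordFrame hF η).self_of_nhds,
    (eventually_eq_sum_coordFrame hF ζ).self_of_nhds]
  rw [covAlong_eq, covAlong_eq, covAlong_eq, form_sum, form_sum, form_sum, ← Finset.sum_add_distrib,
    ← Finset.sum_add_distrib]
  refine Finset.sum_congr rfl fun l _ ↦ ?_
  obtain ⟨i, j, k⟩ := l
  have h1 := mvfderiv_mul_apply (((hc i).mul (hd j)).mul (he k)) ((hg i j k).comp s hF) w
  have h2 := mvfderiv_mul_apply ((hc i).mul (hd j)) (he k) w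
  have h2' := mvfderiv_mul_apply (hc i) (hd j) w
  have h3 := mvfderiv_comp_apply s (hg i j k) hF w
  have h4 := hΦ.parallel _ _ _ _ (hE i) (hE j) (hE k) (mfderiv (𝓡 2) (𝓡 7) F s w)
  simp only [Function.comp_def, Pi.mul_def] at h1 h2 h2' h3 h4
  dsimp only
  rw [h1, h2, h2', h3, h4]
  simp only [← trilinear_apply, map_smul, map_add, LinearMap.smul_apply, LinearMap.add_apply,
    smul_eq_mul]
  ring

end Parallel

/-! ### Coordinate fields and the torsion along a surface -/

section Coordinates

variable {S : Type*} [TopologicalSpace S] [ChartedSpace (EuclideanSpace ℝ (Fin 2)) S]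
  {s : S}

theorem contDiffAt_comp_extChartAt_symm {g : S → ℝ} (hg : ContMDiffAt (𝓡 2) 𝓘(ℝ, ℝ) ∞ g s) :
    ContDiffAt ℝ ∞ (g ∘ (extChartAt (𝓡 2) s).symm) (extChartAt (𝓡 2) s s) := by
  have h := (contMDiffAt_iff.1 hg).2
  rw [ModelWithCorners.range_eq_univ, contDiffWithinAt_univ] at h
  exact h

theorem contDiffAt_fderiv_comp_extChartAt_symm {g : S → ℝ}
    (hg : ContMDiffAt (𝓡 2) 𝓘(ℝ, ℝ) ∞ g s) :
    ContDiffAt ℝ ∞ (fderiv ℝ (g ∘ (extChartAt (𝓡 2) s).symm)) (extChartAt (𝓡 2) s s) :=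
  (contDiffAt_comp_extChartAt_symm hg).fderiv_right (by simp)

variable [IsManifold (𝓡 2) ∞ S]

/-- The vector field on `S` near `s` with constant coefficients in the chart at `s` and with
value `w` at `s`. -/
abbrev coordField {s : S} (w : TangentSpace (𝓡 2) s) : (t : S) → TangentSpace (𝓡 2) t :=
  FiberBundle.extend (EuclideanSpace ℝ (Fin 2)) w

theorem coordField_self (w : TangentSpace (𝓡 2) s) : coordField w s = w :=
  FiberBundle.extend_apply_self _ w

theorem coordField_eq (w : TangentSpace (𝓡 2) s) {t : S}
    (ht : t ∈ (chartAt (EuclideanSpace ℝ (Fin 2)) s).source) :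
    coordField w t = mfderiv 𝓘(ℝ, EuclideanSpace ℝ (Fin 2)) (𝓡 2) (extChartAt (𝓡 2) s).symm
      (extChartAt (𝓡 2) s t) w := by
  have hb : t ∈ (trivializationAt (EuclideanSpace ℝ (Fin 2))
      (TangentSpace (𝓡 2) : S → Type _) s).baseSet := by
    rwa [TangentBundle.trivializationAt_baseSet]
  have hb0 := FiberBundle.mem_baseSet_trivializationAt' (F := EuclideanSpace ℝ (Fin 2))
    (E := (TangentSpace (𝓡 2) : S → Type _)) s
  have h1 := TangentBundle.symmL_trivializationAt (I := 𝓡 2) ht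
  have h2 := mfderiv_extChartAt_self (I := 𝓡 2) (x := s)
  rw [← TangentBundle.continuousLinearMapAt_trivializationAt (by simp)] at h2
  have h3 := congrArg (fun A : TangentSpace (𝓡 2) s →L[ℝ] EuclideanSpace ℝ (Fin 2) ↦ A w) h2
  simp only [Trivialization.continuousLinearMapAt_apply] at h3
  rw [Trivialization.coe_linearMapAt_of_mem _ hb0] at h3
  rw [ModelWithCorners.range_eq_univ, mfderivWithin_univ] at h1
  rw [← h1]
  refine Eq.trans ?_ (Trivialization.symmL_apply _ hb _).symm
  exact congrArg _ h3

/-- The derivative of a function along a coordinate field is the partial derivative of its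
coordinate expression. -/
theorem mvfderiv_coordField {g : S → ℝ} (w : TangentSpace (𝓡 2) s) {t : S}
    (ht : t ∈ (chartAt (EuclideanSpace ℝ (Fin 2)) s).source)
    (hg : MDifferentiableAt (𝓡 2) 𝓘(ℝ, ℝ) g t) :
    mvfderiv (𝓡 2) g t (coordField w t) =
      fderiv ℝ (g ∘ (extChartAt (𝓡 2) s).symm) (extChartAt (𝓡 2) s t)
        (w : EuclideanSpace ℝ (Fin 2)) := by
  have ht' : t ∈ (extChartAt (𝓡 2) s).source := by rwa [extChartAt_source]
  have hs : MDifferentiableAt 𝓘(ℝ, EuclideanSpace ℝ (Fin 2)) (𝓡 2) (extChartAt (𝓡 2) s).symm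
      (extChartAt (𝓡 2) s t) := by
    have := mdifferentiableWithinAt_extChartAt_symm ((extChartAt (𝓡 2) s).map_source ht')
    rwa [ModelWithCorners.range_eq_univ, mdifferentiableWithinAt_univ] at this
  have hinv : (extChartAt (𝓡 2) s).symm (extChartAt (𝓡 2) s t) = t :=
    (extChartAt (𝓡 2) s).left_inv ht'
  rw [coordField_eq w ht, ← mfderiv_eq_fderiv]
  have h := mvfderiv_comp_apply_of_eq (extChartAt (𝓡 2) s t) hg hs hinv w
  exact h.symm

theorem eventually_mvfderiv_coordField {g : S → ℝ} (hg : ContMDiffAt (𝓡 2) 𝓘(ℝ, ℝ) ∞ g s)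
    (w : TangentSpace (𝓡 2) s) :
    (fun t ↦ mvfderiv (𝓡 2) g t (coordField w t)) =ᶠ[nhds s]
      (fun u ↦ fderiv ℝ (g ∘ (extChartAt (𝓡 2) s).symm) u (w : EuclideanSpace ℝ (Fin 2))) ∘
        extChartAt (𝓡 2) s := by
  have h1 : ContMDiffAt (𝓡 2) 𝓘(ℝ, ℝ) 1 g s := hg.of_le (by simp)
  filter_upwards [(contMDiffAt_iff_contMDiffAt_nhds (by simp)).1 h1,
    (chartAt (EuclideanSpace ℝ (Fin 2)) s).open_source.mem_nhds (mem_chart_source _ s)]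
    with t h ht
  exact mvfderiv_coordField w ht (h.mdifferentiableAt one_ne_zero)

theorem contMDiffAt_mvfderiv_coordField {g : S → ℝ} (hg : ContMDiffAt (𝓡 2) 𝓘(ℝ, ℝ) ∞ g s)
    (w : TangentSpace (𝓡 2) s) :
    ContMDiffAt (𝓡 2) 𝓘(ℝ, ℝ) ∞ (fun t ↦ mvfderiv (𝓡 2) g t (coordField w t)) s := by
  refine ContMDiffAt.congr_of_eventuallyEq ?_ (eventually_mvfderiv_coordField hg w)
  exact ((contDiffAt_fderiv_comp_extChartAt_symm hg).clm_apply
    contDiffAt_const).contMDiffAt.comp s contMDiffAt_extChartAt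

/-- Coordinate fields commute: the symmetry of the second derivative. -/
theorem mvfderiv_mvfderiv_coordField_comm {g : S → ℝ}
    (hg : ContMDiffAt (𝓡 2) 𝓘(ℝ, ℝ) ∞ g s) (v w : TangentSpace (𝓡 2) s) :
    mvfderiv (𝓡 2) (fun t ↦ mvfderiv (𝓡 2) g t (coordField w t)) s v =
      mvfderiv (𝓡 2) (fun t ↦ mvfderiv (𝓡 2) g t (coordField v t)) s w := by
  set h : EuclideanSpace ℝ (Fin 2) → ℝ := g ∘ (extChartAt (𝓡 2) s).symm with hh
  have hd : DifferentiableAt ℝ (fderiv ℝ h) (extChartAt (𝓡 2) s s) :=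
    (contDiffAt_fderiv_comp_extChartAt_symm hg).differentiableAt (by simp)
  have second : ∀ a b : EuclideanSpace ℝ (Fin 2),
      fderiv ℝ (fun u ↦ fderiv ℝ h u b) (extChartAt (𝓡 2) s s) a =
        fderiv ℝ (fderiv ℝ h) (extChartAt (𝓡 2) s s) a b := by
    intro a b
    rw [(hd.hasFDerivAt.clm_apply (hasFDerivAt_const b _)).fderiv]
    simp
  have key : ∀ a b : TangentSpace (𝓡 2) s,
      mvfderiv (𝓡 2) (fun t ↦ mvfderiv (𝓡 2) g t (coordField b t)) s a =
        fderiv ℝ (fderiv ℝ h) (extChartAt (𝓡 2) s s) (a : EuclideanSpace ℝ (Fin 2))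
          (b : EuclideanSpace ℝ (Fin 2)) := by
    intro a b
    have h2 : DifferentiableAt ℝ (fun u ↦ fderiv ℝ h u (b : EuclideanSpace ℝ (Fin 2)))
        (extChartAt (𝓡 2) s s) := hd.clm_apply (differentiableAt_const _)
    have h1 := mvfderiv_comp_apply s h2.mdifferentiableAt
      (mdifferentiableAt_extChartAt (I := 𝓡 2) (mem_chart_source _ s)) a
    rw [mfderiv_extChartAt_self] at h1
    have h3 : mvfderiv 𝓘(ℝ, EuclideanSpace ℝ (Fin 2))
        (fun u ↦ fderiv ℝ h u (b : EuclideanSpace ℝ (Fin 2))) (extChartAt (𝓡 2) s s) =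
        fderiv ℝ (fun u ↦ fderiv ℝ h u (b : EuclideanSpace ℝ (Fin 2)))
          (extChartAt (𝓡 2) s s) := mfderiv_eq_fderiv
    exact (((mvfderiv_congr (eventually_mvfderiv_coordField hg b) a).trans h1).trans
      (congrArg (fun A : EuclideanSpace ℝ (Fin 2) →L[ℝ] ℝ ↦ A a) h3)).trans (second a b)
  rw [key, key]
  refine (contDiffAt_comp_extChartAt_symm hg).isSymmSndFDerivAt ?_ _ _
  rw [minSmoothness_of_isRCLikeNormedField]
  exact ENat.LEInfty.out

end Coordinates

section Torsion

variable {M : Type*} [TopologicalSpace M] [ChartedSpace (EuclideanSpace ℝ (Fin 7)) M]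
  {S : Type*} [TopologicalSpace S] [ChartedSpace (EuclideanSpace ℝ (Fin 2)) S]
  {F : S → M} {s : S}

theorem contMDiffAt_extChartAt_comp [IsManifold (𝓡 7) ∞ M]
    (hF : ContMDiffAt (𝓡 2) (𝓡 7) ∞ F s) (i : Fin 7) :
    ContMDiffAt (𝓡 2) 𝓘(ℝ, ℝ) ∞
      (fun t ↦ (extChartAt (𝓡 7) (F s) (F t) : EuclideanSpace ℝ (Fin 7)) i) s :=
  contMDiffAt_euclidean_iff.1 (contMDiffAt_extChartAt.comp s hF) i

variable [IsManifold (𝓡 7) ∞ M]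
  {nabla : CovariantDerivative (𝓡 7) (EuclideanSpace ℝ (Fin 7))
    (fun x : M => TangentSpace (𝓡 7) x)}

theorem coordFrame_eq {p x : M} (hx : x ∈ (chartAt (EuclideanSpace ℝ (Fin 7)) p).source)
    (i : Fin 7) :
    coordFrame p i x = mfderivWithin 𝓘(ℝ, EuclideanSpace ℝ (Fin 7)) (𝓡 7)
      (extChartAt (𝓡 7) p).symm (Set.range (𝓡 7)) (extChartAt (𝓡 7) p x)
      (EuclideanSpace.basisFun (Fin 7) ℝ i) := by
  have hb : x ∈ (triv p).baseSet := by rwa [TangentBundle.trivializationAt_baseSet]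
  rw [← TangentBundle.symmL_trivializationAt (I := 𝓡 7) hx, coordFrame,
    Trivialization.localFrame_apply_of_mem_baseSet _ _ hb, Trivialization.basisAt]
  simp only [Module.Basis.map_apply, OrthonormalBasis.coe_toBasis]
  exact (Trivialization.symmL_apply _ hb _).symm

theorem mlieBracket_coordFrame (p : M) (i j : Fin 7) :
    VectorField.mlieBracket (𝓡 7) (coordFrame p i) (coordFrame p j) p = 0 := by
  -- the coordinate fields pull back to constant fields in the chart
  have key : ∀ k : Fin 7,
      VectorField.mpullbackWithin 𝓘(ℝ, EuclideanSpace ℝ (Fin 7)) (𝓡 7)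
        (extChartAt (𝓡 7) p).symm (coordFrame p k) (Set.range (𝓡 7)) =ᶠ[nhds (extChartAt (𝓡 7) p p)]
      fun _ ↦ EuclideanSpace.basisFun (Fin 7) ℝ k := by
    intro k
    filter_upwards [extChartAt_target_mem_nhds (I := 𝓡 7) p] with u hu
    have hx : (extChartAt (𝓡 7) p).symm u ∈ (chartAt (EuclideanSpace ℝ (Fin 7)) p).source := by
      rw [← extChartAt_source (𝓡 7)]
      exact (extChartAt (𝓡 7) p).map_target hu
    rw [VectorField.mpullbackWithin_apply, coordFrame_eq hx, (extChartAt (𝓡 7) p).right_inv hu]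
    exact (isInvertible_mfderivWithin_extChartAt_symm hu).inverse_apply_self _
  have h1 := Filter.EventuallyEq.lieBracketWithin_vectorField_eq (𝕜 := ℝ)
    (s := (extChartAt (𝓡 7) p).symm ⁻¹' Set.univ ∩ Set.range (𝓡 7))
    ((key i).filter_mono nhdsWithin_le_nhds) (key i).self_of_nhds
    ((key j).filter_mono nhdsWithin_le_nhds) (key j).self_of_nhds
  have h2 : VectorField.lieBracketWithin ℝ (fun _ ↦ EuclideanSpace.basisFun (Fin 7) ℝ i)
      (fun _ ↦ EuclideanSpace.basisFun (Fin 7) ℝ j)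
      ((extChartAt (𝓡 7) p).symm ⁻¹' Set.univ ∩ Set.range (𝓡 7)) (extChartAt (𝓡 7) p p) = 0 := by
    simp [VectorField.lieBracketWithin]
  exact (congrArg (mfderiv (𝓡 7) 𝓘(ℝ, EuclideanSpace ℝ (Fin 7))
    (extChartAt (𝓡 7) p) p).inverse (h1.trans h2)).trans (map_zero _)

/-- The coefficients of a tangent vector in a coordinate frame are the derivatives of the coordinate
functions. -/
theorem coordCoeff_eq_mvfderiv {p x : M}
    (hx : x ∈ (chartAt (EuclideanSpace ℝ (Fin 7)) p).source) (i : Fin 7)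
    (v : TangentSpace (𝓡 7) x) :
    coordCoeff p i x v =
      mvfderiv (𝓡 7) (fun y ↦ (extChartAt (𝓡 7) p y : EuclideanSpace ℝ (Fin 7)) i) x v := by
  have hb : x ∈ (triv p).baseSet := by rwa [TangentBundle.trivializationAt_baseSet]
  have h1 := TangentBundle.continuousLinearMapAt_trivializationAt (I := 𝓡 7) hx
  have hl : MDifferentiableAt 𝓘(ℝ, EuclideanSpace ℝ (Fin 7)) 𝓘(ℝ, ℝ)
      (EuclideanSpace.proj i : EuclideanSpace ℝ (Fin 7) →L[ℝ] ℝ) (extChartAt (𝓡 7) p x) :=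
    (EuclideanSpace.proj i : EuclideanSpace ℝ (Fin 7) →L[ℝ] ℝ).differentiableAt.mdifferentiableAt
  have h2 := mvfderiv_comp_apply x hl (mdifferentiableAt_extChartAt (I := 𝓡 7) hx) v
  have h3 : mvfderiv 𝓘(ℝ, EuclideanSpace ℝ (Fin 7))
      (EuclideanSpace.proj i : EuclideanSpace ℝ (Fin 7) →L[ℝ] ℝ) (extChartAt (𝓡 7) p x) =
      (EuclideanSpace.proj i : EuclideanSpace ℝ (Fin 7) →L[ℝ] ℝ) :=
    mfderiv_eq_fderiv.trans (ContinuousLinearMap.fderiv _)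
  have h4 : (triv p).continuousLinearMapAt ℝ x v =
      (triv p (⟨x, v⟩ : TangentBundle (𝓡 7) M)).2 := by
    rw [Trivialization.continuousLinearMapAt_apply, Trivialization.coe_linearMapAt_of_mem _ hb]
  rw [coordCoeff_eq hb]
  refine Eq.trans ?_ h2.symm
  rw [h3, ← h1]
  exact congrArg (fun y : EuclideanSpace ℝ (Fin 7) ↦ y i) h4.symm

theorem coordCoeff_mfderiv (hF : MDifferentiableAt (𝓡 2) (𝓡 7) F s) {p : M}
    (hp : F s ∈ (chartAt (EuclideanSpace ℝ (Fin 7)) p).source) (i : Fin 7)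
    (v : TangentSpace (𝓡 2) s) :
    coordCoeff p i (F s) (mfderiv (𝓡 2) (𝓡 7) F s v) =
      mvfderiv (𝓡 2) (fun t ↦ (extChartAt (𝓡 7) p (F t) : EuclideanSpace ℝ (Fin 7)) i) s v := by
  rw [coordCoeff_eq_mvfderiv hp]
  have hl : MDifferentiableAt (𝓡 7) 𝓘(ℝ, ℝ)
      (fun y ↦ (extChartAt (𝓡 7) p y : EuclideanSpace ℝ (Fin 7)) i) (F s) :=
    ((EuclideanSpace.proj i :
      EuclideanSpace ℝ (Fin 7) →L[ℝ] ℝ).differentiableAt.mdifferentiableAt).comp (F s)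
      (mdifferentiableAt_extChartAt (I := 𝓡 7) hp)
  exact (mvfderiv_comp_apply s hl hF v).symm

variable [IsManifold (𝓡 2) ∞ S]

theorem eventually_coordCoeff_mfderiv (hF : ContMDiffAt (𝓡 2) (𝓡 7) ∞ F s) (i : Fin 7)
    (w : TangentSpace (𝓡 2) s) :
    (fun t ↦ coordCoeff (F s) i (F t) (mfderiv (𝓡 2) (𝓡 7) F t (coordField w t))) =ᶠ[nhds s]
      fun t ↦ mvfderiv (𝓡 2) (fun t ↦ (extChartAt (𝓡 7) (F s) (F t) :
        EuclideanSpace ℝ (Fin 7)) i) t (coordField w t) := by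
  have h1 : ContMDiffAt (𝓡 2) (𝓡 7) 1 F s := hF.of_le (by simp)
  filter_upwards [(contMDiffAt_iff_contMDiffAt_nhds (by simp)).1 h1,
    hF.continuousAt.eventually ((chartAt (EuclideanSpace ℝ (Fin 7)) (F s)).open_source.mem_nhds
      (mem_chart_source _ (F s)))] with t h ht
  exact coordCoeff_mfderiv (h.mdifferentiableAt one_ne_zero) ht i _

theorem smoothAlongAt_mfderiv_coordField (hF : ContMDiffAt (𝓡 2) (𝓡 7) ∞ F s)
    (w : TangentSpace (𝓡 2) s) :
    SmoothAlongAt F (fun t ↦ mfderiv (𝓡 2) (𝓡 7) F t (coordField w t)) s :=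
  (smoothAlongAt_iff (mem_baseSet_triv_self (F s))).2 ⟨hF, fun i ↦
    (contMDiffAt_mvfderiv_coordField (contMDiffAt_extChartAt_comp hF i) w).congr_of_eventuallyEq
      (eventually_coordCoeff_mfderiv hF i w)⟩

/-- The symmetry of the Christoffel symbols of a torsion-free connection. -/
theorem nabla_coordFrame_comm (htor : nabla.torsion = 0) (p : M) (i j : Fin 7) :
    nabla (coordFrame p i) p (coordFrame p j p) = nabla (coordFrame p j) p (coordFrame p i p) := by
  have hp := mem_baseSet_triv_self p
  have h := (nabla.torsion_eq_zero_iff.1 htor) (diffFieldAt_coordFrame hp j)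
    (diffFieldAt_coordFrame hp i)
  rw [mlieBracket_coordFrame] at h
  exact sub_eq_zero.1 h

/-- The pull-back of a torsion-free connection is symmetric: `∇_v (dF W) = ∇_w (dF V)` for
commuting fields `V`, `W`. -/
theorem covAlong_mfderiv_comm (htor : nabla.torsion = 0) (hF : ContMDiffAt (𝓡 2) (𝓡 7) ∞ F s)
    (v w : TangentSpace (𝓡 2) s) :
    covAlong nabla F (fun t ↦ mfderiv (𝓡 2) (𝓡 7) F t (coordField w t)) s v =
      covAlong nabla F (fun t ↦ mfderiv (𝓡 2) (𝓡 7) F t (coordField v t)) s w := by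
  have hp := mem_baseSet_triv_self (F s)
  rw [covAlong_eq, covAlong_eq, Finset.sum_add_distrib, Finset.sum_add_distrib]
  congr 1
  · refine Finset.sum_congr rfl fun i _ ↦ ?_
    rw [mvfderiv_congr (eventually_coordCoeff_mfderiv hF i w),
      mvfderiv_congr (eventually_coordCoeff_mfderiv hF i v),
      mvfderiv_mvfderiv_coordField_comm (contMDiffAt_extChartAt_comp hF i)]
  · -- what remains is a symmetric double sum over the Christoffel symbols
    simp only [coordField_self]
    have key : ∀ a b : TangentSpace (𝓡 7) (F s),
        ∑ i, coordCoeff (F s) i (F s) a • nabla (coordFrame (F s) i) (F s) b =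
          ∑ i, ∑ j, (coordCoeff (F s) i (F s) a * coordCoeff (F s) j (F s) b) •
            nabla (coordFrame (F s) i) (F s) (coordFrame (F s) j (F s)) := by
      intro a b
      refine Finset.sum_congr rfl fun i _ ↦ ?_
      conv_lhs => rw [← sum_coordCoeff hp b, map_sum, Finset.smul_sum]
      exact Finset.sum_congr rfl fun j _ ↦ by rw [map_smul, smul_smul]
    rw [key, key, Finset.sum_comm]
    refine Finset.sum_congr rfl fun i _ ↦ Finset.sum_congr rfl fun j _ ↦ ?_
    rw [nabla_coordFrame_comm htor, mul_comm]

end Torsion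

/-! ### Smoothness of vector fields along a surface -/

section Smoothness

variable {M : Type*} [TopologicalSpace M] [ChartedSpace (EuclideanSpace ℝ (Fin 7)) M]
  [IsManifold (𝓡 7) ∞ M]
  {S : Type*} [TopologicalSpace S] [ChartedSpace (EuclideanSpace ℝ (Fin 2)) S]
  {nabla : CovariantDerivative (𝓡 7) (EuclideanSpace ℝ (Fin 7))
    (fun x : M => TangentSpace (𝓡 7) x)}
  {F : S → M} {ξ η ζ : (s : S) → TangentSpace (𝓡 7) (F s)} {s : S}

theorem SmoothAlongAt.contMDiffAt (h : SmoothAlongAt F ξ s) : ContMDiffAt (𝓡 2) (𝓡 7) ∞ F s :=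
  ((smoothAlongAt_iff (mem_baseSet_triv_self (F s))).1 h).1

theorem SmoothAlongAt.coordCoeff {p : M} (h : SmoothAlongAt F ξ s)
    (hp : F s ∈ (triv p).baseSet) (i : Fin 7) :
    ContMDiffAt (𝓡 2) 𝓘(ℝ, ℝ) ∞ (fun t ↦ coordCoeff p i (F t) (ξ t)) s :=
  ((smoothAlongAt_iff hp).1 h).2 i

theorem SmoothAlongAt.add (hξ : SmoothAlongAt F ξ s) (hη : SmoothAlongAt F η s) :
    SmoothAlongAt F (fun t ↦ ξ t + η t) s := by
  have hp := mem_baseSet_triv_self (F s)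
  refine (smoothAlongAt_iff hp).2 ⟨SmoothAlongAt.contMDiffAt hξ, fun i ↦ ?_⟩
  simp only [map_add]
  exact (SmoothAlongAt.coordCoeff hξ hp i).add (SmoothAlongAt.coordCoeff hη hp i)

theorem SmoothAlongAt.smul {g : S → ℝ} (hg : ContMDiffAt (𝓡 2) 𝓘(ℝ, ℝ) ∞ g s)
    (hξ : SmoothAlongAt F ξ s) : SmoothAlongAt F (fun t ↦ g t • ξ t) s := by
  have hp := mem_baseSet_triv_self (F s)
  refine (smoothAlongAt_iff hp).2 ⟨SmoothAlongAt.contMDiffAt hξ, fun i ↦ ?_⟩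
  simp only [map_smul, smul_eq_mul]
  exact hg.mul (SmoothAlongAt.coordCoeff hξ hp i)

theorem SmoothAlongAt.congr (hξ : SmoothAlongAt F ξ s) (h : ∀ᶠ t in nhds s, η t = ξ t) :
    SmoothAlongAt F η s :=
  ContMDiffAt.congr_of_eventuallyEq hξ (h.mono fun t ht ↦ by simp only [ht])

theorem SmoothAlongAt.sum {ι : Type*} (hF : ContMDiffAt (𝓡 2) (𝓡 7) ∞ F s) (J : Finset ι)
    {ξ : ι → (s : S) → TangentSpace (𝓡 7) (F s)} (hξ : ∀ j ∈ J, SmoothAlongAt F (ξ j) s) :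
    SmoothAlongAt F (fun t ↦ ∑ j ∈ J, ξ j t) s := by
  have hp := mem_baseSet_triv_self (F s)
  refine (smoothAlongAt_iff hp).2 ⟨hF, fun i ↦ ?_⟩
  simp only [map_sum]
  exact contMDiffAt_finsetSum fun j hj ↦ SmoothAlongAt.coordCoeff (hξ j hj) hp i

/-- The restriction of a smooth vector field of `M` to `F`. -/
theorem smoothAlongAt_comp {X : (x : M) → TangentSpace (𝓡 7) x}
    (hF : ContMDiffAt (𝓡 2) (𝓡 7) ∞ F s)
    (hX : ContMDiffAt (𝓡 7) (𝓡 7).tangent ∞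
      (fun y ↦ (⟨y, X y⟩ : TangentBundle (𝓡 7) M)) (F s)) :
    SmoothAlongAt F (fun t ↦ X (F t)) s :=
  ContMDiffAt.comp s hX hF

theorem SmoothAlongAt.eventually [IsManifold (𝓡 2) ∞ S] (h : SmoothAlongAt F ξ s) :
    ∀ᶠ t in nhds s, DiffAlongAt F ξ t := by
  have h1 : ContMDiffAt (𝓡 2) (𝓡 7).tangent 1
      (fun t => (⟨F t, ξ t⟩ : TangentBundle (𝓡 7) M)) s := ContMDiffAt.of_le h (by simp)
  exact ((contMDiffAt_iff_contMDiffAt_nhds (by simp)).1 h1).mono fun t ht ↦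
    ht.mdifferentiableAt one_ne_zero

theorem eventually_nabla_eq {X X' : (x : M) → TangentSpace (𝓡 7) x} {x : M}
    (hX : ContMDiffAt (𝓡 7) (𝓡 7).tangent ∞
      (fun y ↦ (⟨y, X y⟩ : TangentBundle (𝓡 7) M)) x)
    (h : ∀ᶠ y in nhds x, X' y = X y) : ∀ᶠ y in nhds x, nabla X' y = nabla X y := by
  have h1 : ContMDiffAt (𝓡 7) (𝓡 7).tangent 1
      (fun y => (⟨y, X y⟩ : TangentBundle (𝓡 7) M)) x := ContMDiffAt.of_le hX (by simp)
  filter_upwards [(contMDiffAt_iff_contMDiffAt_nhds (by simp)).1 h1,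
    eventually_eventually_nhds.2 h] with y hy hy'
  have hd : DiffFieldAt X y := hy.mdifferentiableAt one_ne_zero
  have hd' : DiffFieldAt X' y :=
    hd.congr_of_eventuallyEq (hy'.mono fun z hz ↦ by simp only [hz])
  exact nabla.isCovariantDerivativeOnUniv.congr_of_eventuallyEq hd' hd Filter.univ_mem hy'

/-- A smooth connection differentiates coordinate fields to smooth sections of the bundle of
endomorphisms. The coordinate field is cut off, since the smoothness of the connection is a
statement about global vector fields. -/
theorem contMDiffAt_nabla_coordFrame [T2Space M] (hnabla : nabla.ContMDiffCovariantDerivative ∞)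
    (p : M) (i : Fin 7) :
    ContMDiffAt (𝓡 7)
      ((𝓡 7).prod 𝓘(ℝ, EuclideanSpace ℝ (Fin 7) →L[ℝ] EuclideanSpace ℝ (Fin 7))) ∞
      (fun y ↦ TotalSpace.mk' (EuclideanSpace ℝ (Fin 7) →L[ℝ] EuclideanSpace ℝ (Fin 7))
        (E := fun x : M ↦ TangentSpace (𝓡 7) x →L[ℝ] TangentSpace (𝓡 7) x) y
        (nabla (coordFrame p i) y)) p := by
  let ρ : SmoothBumpFunction (𝓡 7) p := Classical.arbitrary _
  have hσ : ContMDiff (𝓡 7) (𝓡 7).tangent ∞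
      (fun y ↦ (⟨y, ρ y • coordFrame p i y⟩ : TangentBundle (𝓡 7) M)) := by
    refine ContMDiffOn.smul_section_of_tsupport (u := (triv p).baseSet) ρ.contMDiff.contMDiffOn
      (triv p).open_baseSet ?_ fun y hy ↦ (contMDiffAt_coordFrame hy i).contMDiffWithinAt
    rw [TangentBundle.trivializationAt_baseSet]
    exact ρ.tsupport_subset_chartAt_source
  have h := hnabla.contMDiff.contMDiff (σ := fun y ↦ ρ y • coordFrame p i y)
    (by simpa using hσ.contMDiffOn)
  refine (h.contMDiffAt Filter.univ_mem).congr_of_eventuallyEq ?_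
  have hev : ∀ᶠ y in nhds p, coordFrame p i y = ρ y • coordFrame p i y :=
    ρ.eventuallyEq_one.mono fun y hy ↦ by rw [hy]; simp
  filter_upwards [eventually_nabla_eq (nabla := nabla) hσ.contMDiffAt hev] with y hy
  rw [hy]

theorem smoothAlongAt_covAlong [T2Space M] [IsManifold (𝓡 2) ∞ S]
    (hnabla : nabla.ContMDiffCovariantDerivative ∞) (hξ : SmoothAlongAt F ξ s)
    (w : TangentSpace (𝓡 2) s) :
    SmoothAlongAt F (fun t ↦ covAlong nabla F ξ t (coordField w t)) s := by
  have hp := mem_baseSet_triv_self (F s)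
  have hF := SmoothAlongAt.contMDiffAt hξ
  have hE := fun i ↦ smoothAlongAt_comp hF (contMDiffAt_coordFrame hp i)
  have hN : ∀ i, SmoothAlongAt F (fun t ↦ nabla (coordFrame (F s) i) (F t)
      (mfderiv (𝓡 2) (𝓡 7) F t (coordField w t))) s := fun i ↦
    ContMDiffAt.clm_bundle_apply
      (ContMDiffAt.comp s (contMDiffAt_nabla_coordFrame hnabla (F s) i) hF)
      (smoothAlongAt_mfderiv_coordField hF w)
  refine SmoothAlongAt.congr (SmoothAlongAt.sum hF Finset.univ fun i _ ↦ SmoothAlongAt.add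
    (SmoothAlongAt.smul (contMDiffAt_mvfderiv_coordField (SmoothAlongAt.coordCoeff hξ hp i) w)
      (hE i)) (SmoothAlongAt.smul (SmoothAlongAt.coordCoeff hξ hp i) (hN i))) ?_
  filter_upwards [SmoothAlongAt.eventually hξ, hF.continuousAt.eventually
    ((triv (F s)).open_baseSet.mem_nhds hp)] with t ht ht'
  exact covAlong_eq_sum nabla ht ht' _

theorem contMDiffAt_form [RiemannianBundle (fun x : M => TangentSpace (𝓡 7) x)]
    {Φ : (x : M) → TangentSpace (𝓡 7) x [⋀^Fin 3]→ₗ[ℝ] ℝ}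
    (hΦ : IsTorsionFreeG2Structure nabla Φ) (hξ : SmoothAlongAt F ξ s)
    (hη : SmoothAlongAt F η s) (hζ : SmoothAlongAt F ζ s) :
    ContMDiffAt (𝓡 2) 𝓘(ℝ, ℝ) ∞ (fun t ↦ Φ (F t) ![ξ t, η t, ζ t]) s := by
  have hp := mem_baseSet_triv_self (F s)
  have hF := SmoothAlongAt.contMDiffAt hξ
  refine ContMDiffAt.congr_of_eventuallyEq ?_
    (eventually_form_eq_sum Φ (hF.mdifferentiableAt (by simp)) ξ η ζ)
  refine contMDiffAt_finsetSum fun k _ ↦ ?_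
  refine (((SmoothAlongAt.coordCoeff hξ hp _).mul (SmoothAlongAt.coordCoeff hη hp _)).mul
    (SmoothAlongAt.coordCoeff hζ hp _)).mul ?_
  exact ContMDiffAt.comp s (hΦ.smooth _ _ _ _ (contMDiffAt_coordFrame hp k.1)
    (contMDiffAt_coordFrame hp k.2.1) (contMDiffAt_coordFrame hp k.2.2)) hF

end Smoothness

/-! ### The symmetry and the trace of the boundary form -/

section AlongSurface

variable {M : Type*} [TopologicalSpace M] [ChartedSpace (EuclideanSpace ℝ (Fin 7)) M]
  {S : Type*} [TopologicalSpace S] [ChartedSpace (EuclideanSpace ℝ (Fin 2)) S]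

/-- The coordinate basis of the tangent plane of `S` at `s`. -/
abbrev coordBasis (s : S) (i : Fin 2) : TangentSpace (𝓡 2) s :=
  EuclideanSpace.basisFun (Fin 2) ℝ i

section Sections

variable [IsManifold (𝓡 7) ∞ M]

/-- `ξ` is a smooth section of `L` near `s`. -/
def IsSectionAt (F : S → M) (L : (s : S) → Submodule ℝ (TangentSpace (𝓡 7) (F s))) (s : S)
    (ξ : (s : S) → TangentSpace (𝓡 7) (F s)) : Prop :=
  SmoothAlongAt F ξ s ∧ ∀ᶠ t in nhds s, ξ t ∈ L t

theorem IsSmoothPlaneBundle.exists_sectionAt {F : S → M}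
    {L : (s : S) → Submodule ℝ (TangentSpace (𝓡 7) (F s))} (hL : IsSmoothPlaneBundle F L) {s : S}
    {l : TangentSpace (𝓡 7) (F s)} (hl : l ∈ L s) : ∃ ξ, IsSectionAt F L s ξ ∧ ξ s = l := by
  obtain ⟨U, hU, hs, a, b, ha, hb, hspan⟩ := hL.exists_frame s
  rw [hspan s hs] at hl
  obtain ⟨c, d, hcd⟩ := Submodule.mem_span_pair.1 hl
  have ha' : SmoothAlongAt F a s := ContMDiffOn.contMDiffAt ha (hU.mem_nhds hs)
  have hb' : SmoothAlongAt F b s := ContMDiffOn.contMDiffAt hb (hU.mem_nhds hs)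
  refine ⟨fun t ↦ c • a t + d • b t, ⟨SmoothAlongAt.add (SmoothAlongAt.smul contMDiffAt_const ha')
    (SmoothAlongAt.smul contMDiffAt_const hb'), ?_⟩, hcd⟩
  filter_upwards [hU.mem_nhds hs] with t ht
  rw [hspan t ht]
  exact Submodule.mem_span_pair.2 ⟨c, d, rfl⟩

end Sections

variable [RiemannianBundle (fun x : M => TangentSpace (𝓡 7) x)]

/-- The area form `Φ(n, ·, ·)` of the surface. -/
def areaForm (Φ : (x : M) → TangentSpace (𝓡 7) x [⋀^Fin 3]→ₗ[ℝ] ℝ) (F : S → M)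
    (n : (s : S) → TangentSpace (𝓡 7) (F s)) (s : S) :
    TangentSpace (𝓡 2) s →ₗ[ℝ] TangentSpace (𝓡 2) s →ₗ[ℝ] ℝ :=
  (trilinear (Φ (F s)) (n s)).compl₁₂ (mfderiv (𝓡 2) (𝓡 7) F s).toLinearMap
    (mfderiv (𝓡 2) (𝓡 7) F s).toLinearMap

section AreaForm

variable {Φ : (x : M) → TangentSpace (𝓡 7) x [⋀^Fin 3]→ₗ[ℝ] ℝ} {F : S → M}
  {n : (s : S) → TangentSpace (𝓡 7) (F s)} {s : S}

theorem areaForm_apply (v w : TangentSpace (𝓡 2) s) :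
    areaForm Φ F n s v w =
      Φ (F s) ![n s, mfderiv (𝓡 2) (𝓡 7) F s v, mfderiv (𝓡 2) (𝓡 7) F s w] := rfl

theorem areaForm_self (v : TangentSpace (𝓡 2) s) : areaForm Φ F n s v v = 0 :=
  form_eq_zero_of_eq _ _ _

end AreaForm

variable [IsManifold (𝓡 7) ∞ M]

/-- A plane bundle `L` along an immersed surface `F : S → M` with a unit normal field `n` such
that `n ×` preserves the tangent planes of `S` and `L`, and `L` is orthogonal to `n` and to the
surface. Thus `n ×` is a complex structure on both planes. These are the properties of the boundary
of an associative submanifold on which the symmetry and the trace of the boundary operator rest. -/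
structure IsComplexPlaneBundle (Φ : (x : M) → TangentSpace (𝓡 7) x [⋀^Fin 3]→ₗ[ℝ] ℝ) (F : S → M)
    (n : (s : S) → TangentSpace (𝓡 7) (F s))
    (L : (s : S) → Submodule ℝ (TangentSpace (𝓡 7) (F s))) : Prop where
  smooth_map : ContMDiff (𝓡 2) (𝓡 7) ∞ F
  injective : ∀ s, Function.Injective (mfderiv (𝓡 2) (𝓡 7) F s)
  smooth_normal : ∀ s, SmoothAlongAt F n s
  inner_self : ∀ s, inner ℝ (n s) (n s) = 1
  inner_tangent : ∀ s v, inner ℝ (n s) (mfderiv (𝓡 2) (𝓡 7) F s v) = 0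
  exists_cross : ∀ s v, ∃ w, mfderiv (𝓡 2) (𝓡 7) F s w =
    cross (Φ (F s)) (n s) (mfderiv (𝓡 2) (𝓡 7) F s v)
  plane : IsSmoothPlaneBundle F L
  cross_mem : ∀ s, ∀ l ∈ L s, cross (Φ (F s)) (n s) l ∈ L s
  inner_plane : ∀ s, ∀ l ∈ L s, inner ℝ (n s) l = 0
  inner_tangent_plane : ∀ s v, ∀ l ∈ L s, inner ℝ (mfderiv (𝓡 2) (𝓡 7) F s v) l = 0

/-- `v` is a unit vector and `w = n × v`. By the properties of the vector product `(v, w)` is then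
an oriented orthonormal frame of the surface (see `IsUnitPair.isOrientedFrame`). -/
def IsUnitPair (Φ : (x : M) → TangentSpace (𝓡 7) x [⋀^Fin 3]→ₗ[ℝ] ℝ) (F : S → M)
    (n : (s : S) → TangentSpace (𝓡 7) (F s)) (s : S) (v w : TangentSpace (𝓡 2) s) : Prop :=
  inner ℝ (mfderiv (𝓡 2) (𝓡 7) F s v) (mfderiv (𝓡 2) (𝓡 7) F s v) = (1 : ℝ) ∧
    mfderiv (𝓡 2) (𝓡 7) F s w = cross (Φ (F s)) (n s) (mfderiv (𝓡 2) (𝓡 7) F s v)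

/-- The covariant derivative of a vector field along `F` is linear in the direction. -/
def covAlongLinear (nabla : CovariantDerivative (𝓡 7) (EuclideanSpace ℝ (Fin 7))
      (fun x : M => TangentSpace (𝓡 7) x)) (F : S → M)
    (ξ : (s : S) → TangentSpace (𝓡 7) (F s)) (s : S) :
    TangentSpace (𝓡 2) s →ₗ[ℝ] TangentSpace (𝓡 7) (F s) where
  toFun := covAlong nabla F ξ s
  map_add' v w := by
    simp only [covAlong_eq, map_add, ← Finset.sum_add_distrib]
    exact Finset.sum_congr rfl fun i _ ↦ by module
  map_smul' c v := by
    simp only [covAlong_eq, map_smul, Finset.smul_sum, RingHom.id_apply, smul_eq_mul]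
    exact Finset.sum_congr rfl fun i _ ↦ by module

/-- The bilinear form `(v, w) ↦ Φ(w, l, ∇_v ξ) - Φ(v, l, ∇_w ξ)`, which for tangent vectors `v`,
`w` of the surface is the pairing of `v × ∇_w ξ - w × ∇_v ξ` with `l`. -/
def boundaryForm (nabla : CovariantDerivative (𝓡 7) (EuclideanSpace ℝ (Fin 7))
      (fun x : M => TangentSpace (𝓡 7) x))
    (Φ : (x : M) → TangentSpace (𝓡 7) x [⋀^Fin 3]→ₗ[ℝ] ℝ) (F : S → M)
    (ξ : (s : S) → TangentSpace (𝓡 7) (F s)) (s : S) (l : TangentSpace (𝓡 7) (F s)) :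
    TangentSpace (𝓡 2) s →ₗ[ℝ] TangentSpace (𝓡 2) s →ₗ[ℝ] ℝ :=
  (((trilinear (Φ (F s))).flip l).compl₁₂ (mfderiv (𝓡 2) (𝓡 7) F s).toLinearMap
      (covAlongLinear nabla F ξ s)).flip
    - ((trilinear (Φ (F s))).flip l).compl₁₂ (mfderiv (𝓡 2) (𝓡 7) F s).toLinearMap
      (covAlongLinear nabla F ξ s)

variable {nabla : CovariantDerivative (𝓡 7) (EuclideanSpace ℝ (Fin 7))
    (fun x : M => TangentSpace (𝓡 7) x)}
  {Φ : (x : M) → TangentSpace (𝓡 7) x [⋀^Fin 3]→ₗ[ℝ] ℝ} {F : S → M}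
  {n ξ φ χ : (s : S) → TangentSpace (𝓡 7) (F s)}
  {L : (s : S) → Submodule ℝ (TangentSpace (𝓡 7) (F s))} {s : S}

theorem boundaryForm_apply (l : TangentSpace (𝓡 7) (F s)) (v w : TangentSpace (𝓡 2) s) :
    boundaryForm nabla Φ F ξ s l v w =
      Φ (F s) ![mfderiv (𝓡 2) (𝓡 7) F s w, l, covAlong nabla F ξ s v]
        - Φ (F s) ![mfderiv (𝓡 2) (𝓡 7) F s v, l, covAlong nabla F ξ s w] := rfl

theorem boundaryForm_self (l : TangentSpace (𝓡 7) (F s)) (v : TangentSpace (𝓡 2) s) :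
    boundaryForm nabla Φ F ξ s l v v = 0 := sub_self _

theorem boundaryForm_add (k l : TangentSpace (𝓡 7) (F s)) (v w : TangentSpace (𝓡 2) s) :
    boundaryForm nabla Φ F ξ s (k + l) v w =
      boundaryForm nabla Φ F ξ s k v w + boundaryForm nabla Φ F ξ s l v w := by
  simp only [boundaryForm_apply, ← trilinear_apply, map_add, LinearMap.add_apply]
  ring

theorem boundaryForm_smul (c : ℝ) (l : TangentSpace (𝓡 7) (F s)) (v w : TangentSpace (𝓡 2) s) :
    boundaryForm nabla Φ F ξ s (c • l) v w = c * boundaryForm nabla Φ F ξ s l v w := by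
  simp only [boundaryForm_apply, ← trilinear_apply, map_smul, LinearMap.smul_apply, smul_eq_mul]
  ring

namespace IsComplexPlaneBundle

theorem form_tangent_eq_zero (hL : IsComplexPlaneBundle Φ F n L) (hΦ : ∀ x, IsG2Form (Φ x))
    (s : S) (v : TangentSpace (𝓡 2) s) {k l : TangentSpace (𝓡 7) (F s)} (hk : k ∈ L s)
    (hl : l ∈ L s) : Φ (F s) ![mfderiv (𝓡 2) (𝓡 7) F s v, k, l] = 0 :=
  (hΦ (F s)).form_eq_zero_of_mem_plane (hL.plane.finrank_eq s) (hL.inner_self s)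
    (hL.inner_plane s) (hL.cross_mem s) (hL.inner_tangent s v) hk hl

theorem exists_unitPair (hL : IsComplexPlaneBundle Φ F n L) (s : S) :
    ∃ v w, IsUnitPair Φ F n s v w := by
  let e := coordBasis s 0
  have he : e ≠ 0 := (EuclideanSpace.basisFun (Fin 2) ℝ).orthonormal.ne_zero 0
  have hne : mfderiv (𝓡 2) (𝓡 7) F s e ≠ 0 := fun h ↦
    he (hL.injective s (h.trans (map_zero _).symm))
  obtain ⟨w, hw⟩ := hL.exists_cross s (‖mfderiv (𝓡 2) (𝓡 7) F s e‖⁻¹ • e)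
  refine ⟨_, w, ?_, hw⟩
  rw [map_smul, real_inner_smul_left, real_inner_smul_right, real_inner_self_eq_norm_sq]
  field_simp [norm_ne_zero_iff.2 hne]

theorem areaForm_eq_one (hL : IsComplexPlaneBundle Φ F n L) (hΦ : ∀ x, IsG2Form (Φ x))
    {v w : TangentSpace (𝓡 2) s} (h : IsUnitPair Φ F n s v w) : areaForm Φ F n s v w = 1 := by
  rw [areaForm_apply, ← inner_cross, h.2,
    (hΦ (F s)).inner_cross_cross_self (hL.inner_self s) (hL.inner_tangent s v), h.1]

/-- An alternating form on the tangent plane of the surface, in terms of its value on an oriented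
orthonormal frame. -/
theorem alternating_eq (hL : IsComplexPlaneBundle Φ F n L) (hΦ : ∀ x, IsG2Form (Φ x))
    {v w : TangentSpace (𝓡 2) s} (h : IsUnitPair Φ F n s v w)
    (b : TangentSpace (𝓡 2) s →ₗ[ℝ] TangentSpace (𝓡 2) s →ₗ[ℝ] ℝ) (hb : ∀ v, b v v = 0)
    (v' w' : TangentSpace (𝓡 2) s) : b v' w' = b v w * areaForm Φ F n s v' w' := by
  have h1 : b v w * areaForm Φ F n s v' w' = b v' w' * areaForm Φ F n s v w :=
    alternating_mul_comm (b := b) (c := areaForm Φ F n s) hb areaForm_self v w v' w'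
  rw [hL.areaForm_eq_one hΦ h, mul_one] at h1
  exact h1.symm

theorem areaForm_basis_ne_zero (hL : IsComplexPlaneBundle Φ F n L) (hΦ : ∀ x, IsG2Form (Φ x))
    (s : S) : areaForm Φ F n s (coordBasis s 0) (coordBasis s 1) ≠ 0 := by
  obtain ⟨v, w, h⟩ := hL.exists_unitPair s
  intro h0
  have h1 := alternating_eq_det_mul (areaForm Φ F n s) areaForm_self v w
  have h2 := hL.areaForm_eq_one hΦ h
  exact zero_ne_one (((h1.trans (congrArg (_ * ·) h0)).trans (mul_zero _)).symm.trans h2)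

/-- Differentiating the identity `Φ(V, χ, φ) = 0` for tangent fields `V` and sections `χ`, `φ`
of `L`. -/
theorem form_covAlong_add_eq_zero [IsManifold (𝓡 2) ∞ S] (hL : IsComplexPlaneBundle Φ F n L)
    (hΦ : IsTorsionFreeG2Structure nabla Φ) (hφ : IsSectionAt F L s φ) (hχ : IsSectionAt F L s χ)
    (v w : TangentSpace (𝓡 2) s) :
    Φ (F s) ![covAlong nabla F (fun t ↦ mfderiv (𝓡 2) (𝓡 7) F t (coordField v t)) s w, χ s, φ s]
      + Φ (F s) ![mfderiv (𝓡 2) (𝓡 7) F s v, covAlong nabla F χ s w, φ s]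
      + Φ (F s) ![mfderiv (𝓡 2) (𝓡 7) F s v, χ s, covAlong nabla F φ s w] = 0 := by
  have hV := smoothAlongAt_mfderiv_coordField (hL.smooth_map s) v
  have h := mvfderiv_form_along hΦ (SmoothAlongAt.diff hV) (SmoothAlongAt.diff hχ.1)
    (SmoothAlongAt.diff hφ.1) w
  have h0 : (fun t ↦ Φ (F t) ![mfderiv (𝓡 2) (𝓡 7) F t (coordField v t), χ t, φ t]) =ᶠ[nhds s]
      fun _ ↦ 0 := by
    filter_upwards [hφ.2, hχ.2] with t h1 h2
    exact hL.form_tangent_eq_zero hΦ.isG2Form t _ h2 h1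
  rw [mvfderiv_congr h0, mvfderiv_const, coordField_self] at h
  exact h.symm

/-- The symmetry of the boundary operator: `∇_v W = ∇_w V` for commuting tangent fields. As
`boundaryForm` depends on `χ` only through `χ s`, this contains that the operator is of order
zero. -/
theorem boundaryForm_comm [IsManifold (𝓡 2) ∞ S] (hL : IsComplexPlaneBundle Φ F n L)
    (htor : nabla.torsion = 0) (hΦ : IsTorsionFreeG2Structure nabla Φ)
    (hφ : IsSectionAt F L s φ) (hχ : IsSectionAt F L s χ) (v w : TangentSpace (𝓡 2) s) :
    boundaryForm nabla Φ F φ s (χ s) v w = boundaryForm nabla Φ F χ s (φ s) v w := by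
  have h1 := hL.form_covAlong_add_eq_zero hΦ hφ hχ w v
  have h2 := hL.form_covAlong_add_eq_zero hΦ hφ hχ v w
  rw [covAlong_mfderiv_comm htor (hL.smooth_map s) v w] at h1
  rw [boundaryForm_apply, boundaryForm_apply, form_swap_right _ _ (covAlong nabla F χ s v),
    form_swap_right _ _ (covAlong nabla F χ s w)]
  linarith

/-- The trace of the boundary form, computed in the orthonormal basis `(φ, χ = n × φ)` of `L`. -/
theorem boundaryForm_add_boundaryForm [IsManifold (𝓡 2) ∞ S]
    [IsContMDiffRiemannianBundle (𝓡 7) ∞ (EuclideanSpace ℝ (Fin 7))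
      (fun x : M => TangentSpace (𝓡 7) x)] (hL : IsComplexPlaneBundle Φ F n L)
    (hmetric : nabla.IsMetricCompatible) (hΦ : IsTorsionFreeG2Structure nabla Φ)
    (hφ : IsSectionAt F L s φ) (hχ : IsSectionAt F L s χ) (hunit : inner ℝ (φ s) (φ s) = (1 : ℝ))
    (hcross : χ s = cross (Φ (F s)) (n s) (φ s)) {v w : TangentSpace (𝓡 2) s}
    (hvw : IsUnitPair Φ F n s v w) :
    boundaryForm nabla Φ F φ s (φ s) v w + boundaryForm nabla Φ F χ s (χ s) v w =
      -inner ℝ (covAlong nabla F n s v) (mfderiv (𝓡 2) (𝓡 7) F s v)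
        + -inner ℝ (covAlong nabla F n s w) (mfderiv (𝓡 2) (𝓡 7) F s w) := by
  have hG := hΦ.isG2Form (F s)
  have hφL := hφ.2.self_of_nhds
  have hnφ := hL.inner_plane s _ hφL
  -- differentiate `⟪n, V⟫ = 0`
  have hII : ∀ u : TangentSpace (𝓡 2) s,
      -inner ℝ (covAlong nabla F n s u) (mfderiv (𝓡 2) (𝓡 7) F s u) = inner ℝ (n s)
        (covAlong nabla F (fun t ↦ mfderiv (𝓡 2) (𝓡 7) F t (coordField u t)) s u) := by
    intro u
    have h := mvfderiv_inner_along hmetric (SmoothAlongAt.diff (hL.smooth_normal s))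
      (SmoothAlongAt.diff (smoothAlongAt_mfderiv_coordField (hL.smooth_map s) u)) u
    rw [mvfderiv_congr (g' := fun _ ↦ 0) (Filter.Eventually.of_forall fun t ↦
      hL.inner_tangent t _), mvfderiv_const, coordField_self] at h
    exact neg_eq_of_add_eq_zero_right h.symm
  -- `φ × χ = n`
  have hn : ∀ x, Φ (F s) ![x, φ s, χ s] = inner ℝ (n s) x := by
    intro x
    rw [← form_rotate, ← inner_cross, hcross, hG.cross_cross_same, hunit, hnφ]
    simp
  -- `v × χ = w × φ` and `w × χ = -v × φ`
  have hv : ∀ x, Φ (F s) ![mfderiv (𝓡 2) (𝓡 7) F s v, χ s, x] =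
      Φ (F s) ![mfderiv (𝓡 2) (𝓡 7) F s w, φ s, x] := by
    intro x
    rw [← inner_cross, ← inner_cross, hcross, hvw.2, hG.cross_cross_of_orthogonal
      (hL.inner_tangent s v) hnφ (hL.inner_tangent_plane s v _ hφL)]
  have hw : ∀ x, Φ (F s) ![mfderiv (𝓡 2) (𝓡 7) F s w, χ s, x] =
      -Φ (F s) ![mfderiv (𝓡 2) (𝓡 7) F s v, φ s, x] := by
    intro x
    have hm := hL.cross_mem s _ hφL
    rw [← inner_cross, hcross, hvw.2, hG.cross_cross_of_orthogonal
      (hL.inner_tangent s v) (hL.inner_plane s _ hm) (hL.inner_tangent_plane s v _ hm),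
      hG.cross_cross_self (hL.inner_self s) hnφ, inner_cross]
    simp only [← trilinear_apply, map_neg, LinearMap.neg_apply]
  have h1 := hL.form_covAlong_add_eq_zero hΦ hχ hφ v v
  have h2 := hL.form_covAlong_add_eq_zero hΦ hχ hφ w w
  rw [hn, form_swap_right _ _ (χ s), hv] at h1
  rw [hn, form_swap_right _ _ (χ s), hw] at h2
  rw [hII, hII, boundaryForm_apply, boundaryForm_apply, hv, hw]
  linarith

end IsComplexPlaneBundle

end AlongSurface

/-! ### The endomorphism field and the boundary of an associative submanifold -/

section Endomorphism

variable {M : Type*} [TopologicalSpace M] [ChartedSpace (EuclideanSpace ℝ (Fin 7)) M]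
  [IsManifold (𝓡 7) ∞ M] [RiemannianBundle (fun x : M => TangentSpace (𝓡 7) x)]
  {S : Type*} [TopologicalSpace S] [ChartedSpace (EuclideanSpace ℝ (Fin 2)) S]
  {nabla : CovariantDerivative (𝓡 7) (EuclideanSpace ℝ (Fin 7))
    (fun x : M => TangentSpace (𝓡 7) x)}
  {Φ : (x : M) → TangentSpace (𝓡 7) x [⋀^Fin 3]→ₗ[ℝ] ℝ} {F : S → M}
  {n ξ ψ : (s : S) → TangentSpace (𝓡 7) (F s)}
  {L : (s : S) → Submodule ℝ (TangentSpace (𝓡 7) (F s))} {s : S}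

namespace IsComplexPlaneBundle

theorem boundaryForm_eq (hL : IsComplexPlaneBundle Φ F n L) (hΦ : ∀ x, IsG2Form (Φ x))
    {v w v' w' : TangentSpace (𝓡 2) s} (h : IsUnitPair Φ F n s v w)
    (h' : IsUnitPair Φ F n s v' w') (l : TangentSpace (𝓡 7) (F s)) :
    boundaryForm nabla Φ F ξ s l v' w' = boundaryForm nabla Φ F ξ s l v w := by
  rw [hL.alternating_eq hΦ h _ (boundaryForm_self l) v' w', hL.areaForm_eq_one hΦ h', mul_one]

theorem exists_unit_mem (hL : IsComplexPlaneBundle Φ F n L) (s : S) :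
    ∃ l ∈ L s, inner ℝ l l = (1 : ℝ) := by
  have h : L s ≠ ⊥ := fun h ↦ by
    have := hL.plane.finrank_eq s
    rw [h, finrank_bot] at this
    omega
  obtain ⟨x, hx, h0⟩ := (L s).ne_bot_iff.1 h
  refine ⟨‖x‖⁻¹ • x, (L s).smul_mem _ hx, ?_⟩
  rw [real_inner_smul_left, real_inner_smul_right, real_inner_self_eq_norm_sq]
  field_simp [norm_ne_zero_iff.2 h0]

variable [IsManifold (𝓡 2) ∞ S]

/-- The operator is of order zero: the boundary form of a section depends only on the value of the
section, and is represented by an endomorphism of the fibre. -/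
theorem exists_endomorphism (hL : IsComplexPlaneBundle Φ F n L) (htor : nabla.torsion = 0)
    (hΦ : IsTorsionFreeG2Structure nabla Φ) (s : S) :
    ∃ A : L s →ₗ[ℝ] L s, ∀ (ξ : (s : S) → TangentSpace (𝓡 7) (F s)), IsSectionAt F L s ξ →
      ∀ k : L s, (k : TangentSpace (𝓡 7) (F s)) = ξ s → ∀ l ∈ L s, ∀ v w,
        IsUnitPair Φ F n s v w →
        inner ℝ (A k : TangentSpace (𝓡 7) (F s)) l = boundaryForm nabla Φ F ξ s l v w := by
  obtain ⟨v₀, w₀, h₀⟩ := hL.exists_unitPair s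
  have : FiniteDimensional ℝ (L s) :=
    Module.finite_of_finrank_pos (by rw [hL.plane.finrank_eq s]; omega)
  obtain ⟨A, hA⟩ := exists_endomorphism_of_symm (L s) (P := IsSectionAt F L s)
    (ev := fun ξ ↦ ξ s) (fun ξ ↦
      { toFun := fun l ↦ boundaryForm nabla Φ F ξ s l v₀ w₀
        map_add' := fun k l ↦ boundaryForm_add k l v₀ w₀
        map_smul' := fun c k ↦ boundaryForm_smul c k v₀ w₀ })
    (fun ξ η hξ hη ↦ hL.boundaryForm_comm htor hΦ hξ hη v₀ w₀)
    (fun l hl ↦ hL.plane.exists_sectionAt hl)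
  exact ⟨A, fun ξ hξ k hk l hl v w h ↦
    (hA ξ hξ k hk l hl).trans (hL.boundaryForm_eq hΦ.isG2Form h h₀ l)⟩

variable [T2Space M]

theorem contMDiffAt_boundaryForm_coordField (hL : IsComplexPlaneBundle Φ F n L)
    (hnabla : nabla.ContMDiffCovariantDerivative ∞) (hΦ : IsTorsionFreeG2Structure nabla Φ)
    {η : (s : S) → TangentSpace (𝓡 7) (F s)} (hξ : SmoothAlongAt F ξ s)
    (hη : SmoothAlongAt F η s) (v w : TangentSpace (𝓡 2) s) :
    ContMDiffAt (𝓡 2) 𝓘(ℝ, ℝ) ∞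
      (fun t ↦ boundaryForm nabla Φ F ξ t (η t) (coordField v t) (coordField w t)) s := by
  have hV := fun v : TangentSpace (𝓡 2) s ↦
    smoothAlongAt_mfderiv_coordField (hL.smooth_map s) v
  exact (contMDiffAt_form hΦ (hV w) hη (smoothAlongAt_covAlong hnabla hξ v)).sub
    (contMDiffAt_form hΦ (hV v) hη (smoothAlongAt_covAlong hnabla hξ w))

/-- A section of `L` representing the boundary form of a smooth section is smooth: its components
in a local frame of `L` are obtained from `boundaryForm` and `areaForm`, evaluated on coordinate
fields, and from the Gram matrix of the frame. -/
theorem smoothAlongAt_of_inner_eq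
    [IsContMDiffRiemannianBundle (𝓡 7) ∞ (EuclideanSpace ℝ (Fin 7))
      (fun x : M => TangentSpace (𝓡 7) x)] (hL : IsComplexPlaneBundle Φ F n L)
    (hnabla : nabla.ContMDiffCovariantDerivative ∞) (hΦ : IsTorsionFreeG2Structure nabla Φ)
    (hξ : SmoothAlongAt F ξ s)
    (hψ : ∀ᶠ t in nhds s, ψ t ∈ L t ∧ ∀ l ∈ L t, ∀ v w, IsUnitPair Φ F n t v w →
      inner ℝ (ψ t) l = boundaryForm nabla Φ F ξ t l v w) :
    SmoothAlongAt F ψ s := by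
  have hG := hΦ.isG2Form
  -- a local frame of `L`, orthonormal at `s`
  obtain ⟨l, hl, hll⟩ := hL.exists_unit_mem s
  obtain ⟨a, ha, has⟩ := hL.plane.exists_sectionAt hl
  obtain ⟨b, hb, hbs⟩ := hL.plane.exists_sectionAt (hL.cross_mem s l hl)
  have haa := ContMDiffAt.inner_bundle ha.1 ha.1
  have hab := ContMDiffAt.inner_bundle ha.1 hb.1
  have hbb := ContMDiffAt.inner_bundle hb.1 hb.1
  have hdet := (haa.mul hbb).sub (hab.mul hab)
  have hdet0 : inner ℝ (a s) (a s) * inner ℝ (b s) (b s)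
      - inner ℝ (a s) (b s) * inner ℝ (a s) (b s) ≠ (0 : ℝ) := by
    rw [has, hbs, (hG (F s)).inner_cross_cross_self (hL.inner_self s) (hL.inner_plane s l hl), hll,
      real_inner_comm, inner_cross_self_right]
    norm_num
  -- the area of the coordinate parallelogram
  have hV := fun i ↦ smoothAlongAt_mfderiv_coordField (hL.smooth_map s) (coordBasis s i)
  have harea : ContMDiffAt (𝓡 2) 𝓘(ℝ, ℝ) ∞ (fun t ↦ areaForm Φ F n t
      (coordField (coordBasis s 0) t) (coordField (coordBasis s 1) t)) s :=
    contMDiffAt_form hΦ (hL.smooth_normal s) (hV 0) (hV 1)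
  have harea0 : areaForm Φ F n s (coordField (coordBasis s 0) s)
      (coordField (coordBasis s 1) s) ≠ 0 := by
    rw [coordField_self, coordField_self]
    exact hL.areaForm_basis_ne_zero hG s
  have hp : ∀ {η : (s : S) → TangentSpace (𝓡 7) (F s)}, IsSectionAt F L s η →
      ContMDiffAt (𝓡 2) 𝓘(ℝ, ℝ) ∞ (fun t ↦ inner ℝ (ψ t) (η t)) s := by
    intro η hη
    refine ((hL.contMDiffAt_boundaryForm_coordField hnabla hΦ hξ hη.1 (coordBasis s 0)
      (coordBasis s 1)).mul (harea.inv₀ harea0)).congr_of_eventuallyEq ?_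
    filter_upwards [hψ, hη.2, harea.continuousAt.eventually_ne harea0] with t h1 h2 h3
    obtain ⟨v, w, hvw⟩ := hL.exists_unitPair t
    rw [h1.2 _ h2 v w hvw]
    refine (eq_mul_inv_iff_mul_eq₀ h3).2 ?_
    exact (hL.alternating_eq hG hvw _ (boundaryForm_self _) _ _).symm
  have hx := ((hbb.mul (hp ha)).sub (hab.mul (hp hb))).mul (hdet.inv₀ hdet0)
  have hy := ((haa.mul (hp hb)).sub (hab.mul (hp ha))).mul (hdet.inv₀ hdet0)
  refine SmoothAlongAt.congr (SmoothAlongAt.add (SmoothAlongAt.smul hx ha.1)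
    (SmoothAlongAt.smul hy hb.1)) ?_
  filter_upwards [hψ, ha.2, hb.2, hdet.continuousAt.eventually_ne hdet0] with t h1 h2 h3 h4
  exact eq_of_gram_ne_zero (hL.plane.finrank_eq t) h2 h3 h1.1 h4

end IsComplexPlaneBundle

end Endomorphism

section Frames

variable {M : Type*} [TopologicalSpace M] [ChartedSpace (EuclideanSpace ℝ (Fin 7)) M]
  [RiemannianBundle (fun x : M => TangentSpace (𝓡 7) x)]
  {Y : Type*}
  {S : Type*} [TopologicalSpace S] [ChartedSpace (EuclideanSpace ℝ (Fin 2)) S]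
  {f : Y → M} {j : S → Y}
  {Φ : (x : M) → TangentSpace (𝓡 7) x [⋀^Fin 3]→ₗ[ℝ] ℝ}
  {n : (s : S) → TangentSpace (𝓡 7) ((f ∘ j) s)}
  {L : (s : S) → Submodule ℝ (TangentSpace (𝓡 7) ((f ∘ j) s))}

theorem IsOrientedFrame.isUnitPair {s : S} {v w : TangentSpace (𝓡 2) s}
    (h : IsOrientedFrame Φ f j n s v w) : IsUnitPair Φ (f ∘ j) n s v w :=
  ⟨by rw [real_inner_self_eq_norm_sq, h.norm_fst, one_pow], h.snd_eq⟩

theorem IsUnitPair.isOrientedFrame [IsManifold (𝓡 7) ∞ M] (hL : IsComplexPlaneBundle Φ (f ∘ j) n L)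
    (hΦ : ∀ x, IsG2Form (Φ x)) {s : S} {v w : TangentSpace (𝓡 2) s}
    (h : IsUnitPair Φ (f ∘ j) n s v w) : IsOrientedFrame Φ f j n s v w where
  norm_fst := by
    rw [norm_eq_sqrt_real_inner, h.1, Real.sqrt_one]
  norm_snd := by
    rw [norm_eq_sqrt_real_inner, h.2, (hΦ _).inner_cross_cross_self (hL.inner_self s)
      (hL.inner_tangent s v), h.1, Real.sqrt_one]
  inner_eq_zero := by
    rw [h.2, real_inner_comm, inner_cross_self_right]
  snd_eq := h.2

end Frames

section Submanifold

variable {M : Type*} [TopologicalSpace M] [ChartedSpace (EuclideanSpace ℝ (Fin 7)) M]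
  {Y : Type*} [TopologicalSpace Y] [ChartedSpace (EuclideanHalfSpace 3) Y]
  {S : Type*} [TopologicalSpace S] [ChartedSpace (EuclideanSpace ℝ (Fin 2)) S]
  {f : Y → M} {j : S → Y}

theorem mfderiv_comp_boundary (hf : IsSubmanifold f) (hj : IsBoundaryInclusion j) (s : S)
    (v : TangentSpace (𝓡 2) s) :
    mfderiv (𝓡 2) (𝓡 7) (f ∘ j) s v =
      mfderiv (𝓡∂ 3) (𝓡 7) f (j s) (mfderiv (𝓡 2) (𝓡∂ 3) j s v) :=
  mfderiv_comp_apply s (hf.smooth.mdifferentiableAt (by simp))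
    (hj.smooth.mdifferentiableAt (by simp)) v

theorem mfderiv_comp_mem_tangentY (hf : IsSubmanifold f) (hj : IsBoundaryInclusion j) (s : S)
    (v : TangentSpace (𝓡 2) s) : mfderiv (𝓡 2) (𝓡 7) (f ∘ j) s v ∈ tangentY f (j s) := by
  rw [mfderiv_comp_boundary hf hj]
  exact LinearMap.mem_range_self _ _

theorem mfderiv_comp_injective (hf : IsSubmanifold f) (hj : IsBoundaryInclusion j) (s : S) :
    Function.Injective (mfderiv (𝓡 2) (𝓡 7) (f ∘ j) s) := fun v w h ↦
  hj.injective s (hf.injective (j s)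
    ((mfderiv_comp_boundary hf hj s v).symm.trans (h.trans (mfderiv_comp_boundary hf hj s w))))

variable [IsManifold (𝓡 7) ∞ M] [RiemannianBundle (fun x : M => TangentSpace (𝓡 7) x)]
  {nabla : CovariantDerivative (𝓡 7) (EuclideanSpace ℝ (Fin 7))
    (fun x : M => TangentSpace (𝓡 7) x)}
  {Φ : (x : M) → TangentSpace (𝓡 7) x [⋀^Fin 3]→ₗ[ℝ] ℝ}
  {n : (s : S) → TangentSpace (𝓡 7) ((f ∘ j) s)}
  {L : (s : S) → Submodule ℝ (TangentSpace (𝓡 7) ((f ∘ j) s))}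

theorem IsInnerUnitNormal.mem_tangentY (hn : IsInnerUnitNormal f j n) (s : S) :
    n s ∈ tangentY f (j s) := by
  obtain ⟨z, hz, _⟩ := hn.inward s
  exact ⟨z, hz⟩

theorem IsInnerUnitNormal.inner_self (hn : IsInnerUnitNormal f j n) (s : S) :
    inner ℝ (n s) (n s) = (1 : ℝ) := by
  rw [real_inner_self_eq_norm_sq, hn.norm_eq_one, one_pow]

theorem IsInnerUnitNormal.inner_tangent (hn : IsInnerUnitNormal f j n) (s : S)
    (v : TangentSpace (𝓡 2) s) :
    inner ℝ (n s) (mfderiv (𝓡 2) (𝓡 7) (f ∘ j) s v) = (0 : ℝ) :=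
  Submodule.inner_left_of_mem_orthogonal (LinearMap.mem_range_self _ v) (hn.orthogonal s)

/-- The tangent vectors of `Y` orthogonal to `n` are tangent to the boundary. -/
theorem mem_tangentBoundary (hf : IsSubmanifold f) (hj : IsBoundaryInclusion j)
    (hn : IsInnerUnitNormal f j n) (s : S) {x : TangentSpace (𝓡 7) ((f ∘ j) s)}
    (hx : x ∈ tangentY f (j s)) (hnx : inner ℝ (n s) x = (0 : ℝ)) :
    x ∈ tangentBoundary f j s := by
  set T : Submodule ℝ (TangentSpace (𝓡 7) ((f ∘ j) s)) := tangentY f (j s)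
  set K : Submodule ℝ (TangentSpace (𝓡 7) ((f ∘ j) s)) := T ⊓ (Submodule.span ℝ {n s})ᗮ
  have hT3 : Module.finrank ℝ T = 3 :=
    (LinearMap.finrank_range_of_inj (hf.injective (j s))).trans
      (finrank_euclideanSpace_fin (𝕜 := ℝ) (n := 3))
  have hB2 : Module.finrank ℝ (tangentBoundary f j s) = 2 :=
    (LinearMap.finrank_range_of_inj (mfderiv_comp_injective hf hj s)).trans
      (finrank_euclideanSpace_fin (𝕜 := ℝ) (n := 2))
  have hBK : tangentBoundary f j s ≤ K := by
    rintro _ ⟨v, rfl⟩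
    exact ⟨mfderiv_comp_mem_tangentY hf hj s v,
      Submodule.mem_orthogonal_singleton_iff_inner_right.2 (hn.inner_tangent s v)⟩
  have hKT : K < T := by
    refine lt_of_le_of_ne inf_le_left fun h ↦ ?_
    have h1 : n s ∈ K := h ▸ hn.mem_tangentY s
    have h2 := Submodule.mem_orthogonal_singleton_iff_inner_right.1 h1.2
    rw [hn.inner_self] at h2
    exact one_ne_zero h2
  have hK3 := Submodule.finrank_lt_finrank_of_lt hKT
  have hle : Module.finrank ℝ K ≤ Module.finrank ℝ (tangentBoundary f j s) := by omega
  rw [Submodule.eq_of_le_of_finrank_le hBK hle]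
  exact ⟨hx, Submodule.mem_orthogonal_singleton_iff_inner_right.2 hnx⟩

/-- A plane subbundle of the normal bundle stable under `n ×` over the boundary of an associative
submanifold is a complex plane bundle. -/
theorem isComplexPlaneBundle (hf : IsSubmanifold f)
    (hassoc : IsAssociative Φ f) (hj : IsBoundaryInclusion j) (hn : IsInnerUnitNormal f j n)
    (hL : IsSmoothPlaneBundle (f ∘ j) L) (hLnormal : ∀ s, L s ≤ normalY f (j s))
    (hLinv : ∀ s, ∀ l ∈ L s, cross (Φ ((f ∘ j) s)) (n s) l ∈ L s) :
    IsComplexPlaneBundle Φ (f ∘ j) n L where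
  smooth_map := hf.smooth.comp hj.smooth
  injective := mfderiv_comp_injective hf hj
  smooth_normal s := ContMDiffOn.contMDiffAt hn.smooth Filter.univ_mem
  inner_self := hn.inner_self
  inner_tangent := hn.inner_tangent
  exists_cross s v := mem_tangentBoundary hf hj hn s
    (hassoc (j s) _ (hn.mem_tangentY s) _ (mfderiv_comp_mem_tangentY hf hj s v))
    (by rw [real_inner_comm]; exact inner_cross_self_left _ _ _)
  plane := hL
  cross_mem := hLinv
  inner_plane s l hl := Submodule.inner_right_of_mem_orthogonal (hn.mem_tangentY s) (hLnormal s hl)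
  inner_tangent_plane s v l hl := Submodule.inner_right_of_mem_orthogonal
    (mfderiv_comp_mem_tangentY hf hj s v) (hLnormal s hl)

/-- The normal projection in the definition of the operator may be dropped after pairing with `L`,
since `v × l` is normal to `Y`. -/
theorem inner_boundaryOperator (hf : IsSubmanifold f) (hassoc : IsAssociative Φ f)
    (hj : IsBoundaryInclusion j) (hLnormal : ∀ s, L s ≤ normalY f (j s))
    (ξ : (s : S) → TangentSpace (𝓡 7) ((f ∘ j) s)) {s : S} {l : TangentSpace (𝓡 7) ((f ∘ j) s)}
    (hl : l ∈ L s) (v w : TangentSpace (𝓡 2) s) :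
    inner ℝ (boundaryOperator nabla Φ f j L ξ s v w) l =
      boundaryForm nabla Φ (f ∘ j) ξ s l v w := by
  have hmem : ∀ u : TangentSpace (𝓡 2) s,
      cross (Φ ((f ∘ j) s)) (mfderiv (𝓡 2) (𝓡 7) (f ∘ j) s u) l ∈ normalY f (j s) := by
    intro u
    refine (Submodule.mem_orthogonal' _ _).2 fun t ht ↦ ?_
    have h1 := hassoc (j s) t ht _ (mfderiv_comp_mem_tangentY hf hj s u)
    have h2 := Submodule.inner_right_of_mem_orthogonal h1 (hLnormal s hl)
    refine (inner_cross _ _ _ _).trans ?_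
    rw [form_rotate, ← inner_cross]
    exact h2
  have hdrop : ∀ u u' : TangentSpace (𝓡 2) s,
      inner ℝ (cross (Φ ((f ∘ j) s)) (mfderiv (𝓡 2) (𝓡 7) (f ∘ j) s u)
        (normalDeriv nabla f j ξ s u')) l =
      -Φ ((f ∘ j) s) ![mfderiv (𝓡 2) (𝓡 7) (f ∘ j) s u, l, covAlong nabla (f ∘ j) ξ s u'] := by
    intro u u'
    rw [inner_cross, form_swap_right, ← inner_cross, ← inner_cross, normalDeriv]
    refine congrArg Neg.neg ?_
    refine (Submodule.inner_starProjection_left_eq_right _ _ _).symm.trans ?_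
    rw [Submodule.starProjection_eq_self_iff.2 (hmem u)]
  rw [boundaryOperator, Submodule.inner_starProjection_left_eq_right,
    Submodule.starProjection_eq_self_iff.2 hl, inner_sub_left, hdrop, hdrop, boundaryForm_apply]
  ring

end Submanifold

/-! ### The mean curvature and the theorem -/

section MeanCurvature

variable {M : Type*} [TopologicalSpace M] [ChartedSpace (EuclideanSpace ℝ (Fin 7)) M]
  [IsManifold (𝓡 7) ∞ M] [RiemannianBundle (fun x : M => TangentSpace (𝓡 7) x)]
  {Y : Type*} [TopologicalSpace Y] [ChartedSpace (EuclideanHalfSpace 3) Y]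
  {S : Type*} [TopologicalSpace S] [ChartedSpace (EuclideanSpace ℝ (Fin 2)) S]
  {f : Y → M} {j : S → Y}
  {nabla : CovariantDerivative (𝓡 7) (EuclideanSpace ℝ (Fin 7))
    (fun x : M => TangentSpace (𝓡 7) x)}
  {Φ : (x : M) → TangentSpace (𝓡 7) x [⋀^Fin 3]→ₗ[ℝ] ℝ}
  {n : (s : S) → TangentSpace (𝓡 7) ((f ∘ j) s)}
  {L : (s : S) → Submodule ℝ (TangentSpace (𝓡 7) ((f ∘ j) s))}

/-- The mean curvature in an oriented orthonormal frame. -/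
theorem two_mul_meanCurvature (hf : IsSubmanifold f) (hj : IsBoundaryInclusion j) {s : S}
    {v w : TangentSpace (𝓡 2) s} (h : IsOrientedFrame Φ f j n s v w) :
    2 * meanCurvature nabla f j n s =
      -inner ℝ (covAlong nabla (f ∘ j) n s v) (mfderiv (𝓡 2) (𝓡 7) (f ∘ j) s v)
        + -inner ℝ (covAlong nabla (f ∘ j) n s w) (mfderiv (𝓡 2) (𝓡 7) (f ∘ j) s w) := by
  let T := (mfderiv (𝓡 2) (𝓡 7) (f ∘ j) s).toLinearMap
  let g : TangentSpace (𝓡 2) s →ₗ[ℝ] TangentSpace (𝓡 2) s →ₗ[ℝ] ℝ :=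
    (innerₗ (TangentSpace (𝓡 7) ((f ∘ j) s))).compl₁₂ T T
  let k : TangentSpace (𝓡 2) s →ₗ[ℝ] TangentSpace (𝓡 2) s →ₗ[ℝ] ℝ :=
    -(innerₗ (TangentSpace (𝓡 7) ((f ∘ j) s))).compl₁₂ (covAlongLinear nabla (f ∘ j) n s) T
  have hvv : g v v = 1 := h.isUnitPair.1
  have hww : g w w = 1 := (real_inner_self_eq_norm_sq _).trans (by rw [h.norm_snd, one_pow])
  have hvw : g v w = 0 := h.inner_eq_zero
  have hwv : g w v = 0 := (real_inner_comm _ _).trans h.inner_eq_zero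
  have h1 : firstForm f j s = Matrix.of fun a b ↦ g (coordBasis s a) (coordBasis s b) := rfl
  have h2 : secondForm nabla f j n s =
      Matrix.of fun a b ↦ k (coordBasis s a) (coordBasis s b) := by
    ext a b
    refine congrArg Neg.neg ?_
    refine (Submodule.inner_starProjection_left_eq_right _ _ _).trans ?_
    exact congrArg (inner ℝ (covAlong nabla (f ∘ j) n s (coordBasis s a)))
      (Submodule.starProjection_eq_self_iff.2 (mfderiv_comp_mem_tangentY hf hj s (coordBasis s b)))
  rw [meanCurvature, mul_div_cancel₀ _ (two_ne_zero (α := ℝ)), h1, h2]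
  exact trace_inv_mul_eq g k hvv hww hvw hwv

end MeanCurvature

end

end AssociativeBoundary


theorem mainTheorem7
    {M : Type*} [TopologicalSpace M] [T2Space M] [ChartedSpace (EuclideanSpace ℝ (Fin 7)) M]
    [IsManifold (𝓡 7) ∞ M] [RiemannianBundle (fun x : M => TangentSpace (𝓡 7) x)]
    [IsContMDiffRiemannianBundle (𝓡 7) ∞ (EuclideanSpace ℝ (Fin 7))
      (fun x : M => TangentSpace (𝓡 7) x)]
    {Y : Type*} [TopologicalSpace Y] [ChartedSpace (EuclideanHalfSpace 3) Y]
    [IsManifold (𝓡∂ 3) ∞ Y]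
    {S : Type*} [TopologicalSpace S] [ChartedSpace (EuclideanSpace ℝ (Fin 2)) S]
    [IsManifold (𝓡 2) ∞ S]
    (nabla : CovariantDerivative (𝓡 7) (EuclideanSpace ℝ (Fin 7))
      (fun x : M => TangentSpace (𝓡 7) x))
    (hnabla : AssociativeBoundary.IsLeviCivita nabla)
    (Φ : (x : M) → TangentSpace (𝓡 7) x [⋀^Fin 3]→ₗ[ℝ] ℝ)
    (hΦ : AssociativeBoundary.IsTorsionFreeG2Structure nabla Φ)
    (f : Y → M) (hf : AssociativeBoundary.IsSubmanifold f)
    (hassoc : AssociativeBoundary.IsAssociative Φ f)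
    (j : S → Y) (hj : AssociativeBoundary.IsBoundaryInclusion j)
    (n : (s : S) → TangentSpace (𝓡 7) ((f ∘ j) s))
    (hn : AssociativeBoundary.IsInnerUnitNormal f j n)
    (L : (s : S) → Submodule ℝ (TangentSpace (𝓡 7) ((f ∘ j) s)))
    (hL : AssociativeBoundary.IsSmoothPlaneBundle (f ∘ j) L)
    (hLnormal : ∀ s, L s ≤ AssociativeBoundary.normalY f (j s))
    (hLinv : ∀ s, ∀ l ∈ L s, AssociativeBoundary.cross (Φ ((f ∘ j) s)) (n s) l ∈ L s) :
    -- oriented orthonormal frames of the boundary exist at every point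
    (∀ s, ∃ v w, AssociativeBoundary.IsOrientedFrame Φ f j n s v w) ∧
    -- the operator does not depend on the frame
    (∀ (U : Set S) (ξ : (s : S) → TangentSpace (𝓡 7) ((f ∘ j) s)), IsOpen U →
      AssociativeBoundary.IsSectionOn (f ∘ j) L U ξ → ∀ s ∈ U, ∀ v w v' w',
      AssociativeBoundary.IsOrientedFrame Φ f j n s v w →
      AssociativeBoundary.IsOrientedFrame Φ f j n s v' w' →
      AssociativeBoundary.boundaryOperator nabla Φ f j L ξ s v w =
        AssociativeBoundary.boundaryOperator nabla Φ f j L ξ s v' w') ∧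
    -- it maps smooth sections of `L` to smooth sections of `L`, and is given by a field `A` of
    -- symmetric endomorphisms of the fibres of `L` with trace `2H`
    ∃ A : (s : S) → L s →ₗ[ℝ] L s,
      (∀ (U : Set S) (ξ : (s : S) → TangentSpace (𝓡 7) ((f ∘ j) s)), IsOpen U →
        ∀ hξ : AssociativeBoundary.IsSectionOn (f ∘ j) L U ξ,
        ∃ ψ : (s : S) → TangentSpace (𝓡 7) ((f ∘ j) s),
          AssociativeBoundary.IsSectionOn (f ∘ j) L U ψ ∧
          ∀ (s : S) (hs : s ∈ U), ψ s = A s ⟨ξ s, hξ.mem s hs⟩ ∧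
            ∀ v w, AssociativeBoundary.IsOrientedFrame Φ f j n s v w →
              AssociativeBoundary.boundaryOperator nabla Φ f j L ξ s v w = ψ s) ∧
      (∀ s, (A s).IsSymmetric) ∧
      (∀ s, LinearMap.trace ℝ (L s) (A s) =
        2 * AssociativeBoundary.meanCurvature nabla f j n s) := by
  have hG := hΦ.isG2Form
  have hC := AssociativeBoundary.isComplexPlaneBundle hf hassoc hj hn hL hLnormal hLinv
  -- a section over an open set is a section near each of its points
  have hsec : ∀ {U : Set S} {ξ : (s : S) → TangentSpace (𝓡 7) ((f ∘ j) s)}, IsOpen U →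
      AssociativeBoundary.IsSectionOn (f ∘ j) L U ξ → ∀ s ∈ U,
      AssociativeBoundary.IsSectionAt (f ∘ j) L s ξ := fun hU hξ s hs ↦
    ⟨ContMDiffOn.contMDiffAt hξ.smooth (hU.mem_nhds hs), Filter.eventually_of_mem
      (hU.mem_nhds hs) hξ.mem⟩
  -- vectors of `L` are determined by their pairings with `L`
  have hext : ∀ (s : S) (x y : TangentSpace (𝓡 7) ((f ∘ j) s)), x ∈ L s → y ∈ L s →
      (∀ l ∈ L s, inner ℝ x l = (inner ℝ y l : ℝ)) → x = y := fun s x y hx hy h ↦ by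
    have h1 := h _ ((L s).sub_mem hx hy)
    rw [← sub_eq_zero, ← inner_sub_left] at h1
    exact sub_eq_zero.1 (inner_self_eq_zero.1 h1)
  have hmem : ∀ ξ (s : S) v w,
      AssociativeBoundary.boundaryOperator nabla Φ f j L ξ s v w ∈ L s := fun ξ s v w ↦
    Submodule.starProjection_apply_mem _ _
  choose A hA using hC.exists_endomorphism hnabla.torsion_eq_zero hΦ
  refine ⟨fun s ↦ ?_, fun U ξ hU hξ s hs v w v' w' h h' ↦ ?_, A, fun U ξ hU hξ ↦ ?_,
    fun s k l ↦ ?_, fun s ↦ ?_⟩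
  · obtain ⟨v, w, h⟩ := hC.exists_unitPair s
    exact ⟨v, w, h.isOrientedFrame hC hG⟩
  · refine hext s _ _ (hmem ξ s v w) (hmem ξ s v' w') fun l hl ↦ ?_
    rw [AssociativeBoundary.inner_boundaryOperator hf hassoc hj hLnormal ξ hl,
      AssociativeBoundary.inner_boundaryOperator hf hassoc hj hLnormal ξ hl,
      hC.boundaryForm_eq hG h'.isUnitPair h.isUnitPair]
  · classical
    have hψ : ∀ s (hs : s ∈ U), (if h : ξ s ∈ L s then
        (A s ⟨ξ s, h⟩ : TangentSpace (𝓡 7) ((f ∘ j) s)) else 0) = A s ⟨ξ s, hξ.mem s hs⟩ :=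
      fun s hs ↦ dif_pos (hξ.mem s hs)
    -- the value off `U` plays no role
    refine ⟨fun s ↦ if h : ξ s ∈ L s then
      (A s ⟨ξ s, h⟩ : TangentSpace (𝓡 7) ((f ∘ j) s)) else 0, ⟨fun s hs ↦ ?_, fun s hs ↦ ?_⟩,
      fun s hs ↦ ⟨hψ s hs, fun v w h ↦ ?_⟩⟩
    · rw [hψ s hs]
      exact (A s _).2
    · refine ContMDiffAt.contMDiffWithinAt (hC.smoothAlongAt_of_inner_eq hnabla.smooth hΦ
        (hsec hU hξ s hs).1 ?_)
      filter_upwards [hU.mem_nhds hs] with t ht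
      rw [hψ t ht]
      exact ⟨(A t _).2, fun l hl v w h ↦ hA t ξ (hsec hU hξ t ht) _ rfl l hl v w h⟩
    · refine Eq.trans (hext s _ _ (hmem ξ s v w) (A s ⟨ξ s, hξ.mem s hs⟩).2 fun l hl ↦ ?_)
        (hψ s hs).symm
      rw [AssociativeBoundary.inner_boundaryOperator hf hassoc hj hLnormal ξ hl,
        hA s ξ (hsec hU hξ s hs) _ rfl l hl v w h.isUnitPair]
  · obtain ⟨v, w, h⟩ := hC.exists_unitPair s
    obtain ⟨φ, hφ, hφs⟩ := hL.exists_sectionAt k.2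
    obtain ⟨χ, hχ, hχs⟩ := hL.exists_sectionAt l.2
    rw [Submodule.coe_inner, Submodule.coe_inner, hA s φ hφ k hφs.symm l l.2 v w h,
      real_inner_comm, hA s χ hχ l hχs.symm k k.2 v w h, ← hφs, ← hχs]
    exact hC.boundaryForm_comm hnabla.torsion_eq_zero hΦ hφ hχ v w
  · obtain ⟨v, w, h⟩ := hC.exists_unitPair s
    obtain ⟨l, hl, hll⟩ := hC.exists_unit_mem s
    have hm := hC.cross_mem s l hl
    obtain ⟨φ, hφ, hφs⟩ := hL.exists_sectionAt hl
    obtain ⟨χ, hχ, hχs⟩ := hL.exists_sectionAt hm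
    obtain ⟨B, hB0, hB1⟩ := AssociativeBoundary.exists_orthonormalBasis_plane (hL.finrank_eq s)
      hl hm hll
      (((hG _).inner_cross_cross_self (hC.inner_self s) (hC.inner_plane s l hl)).trans hll)
      ((real_inner_comm _ _).trans (AssociativeBoundary.inner_cross_self_right _ _ _))
    rw [AssociativeBoundary.two_mul_meanCurvature hf hj (h.isOrientedFrame hC hG),
      ← hC.boundaryForm_add_boundaryForm hnabla.metric hΦ hφ hχ (by rw [hφs, hll])
        (by rw [hχs, hφs]) h, LinearMap.trace_eq_sum_inner _ B, Fin.sum_univ_two]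
    congr 1
    · rw [real_inner_comm, Submodule.coe_inner, hA s φ hφ _ (hB0.trans hφs.symm) _ (B 0).2 v w h,
        hB0, hφs]
    · rw [real_inner_comm, Submodule.coe_inner, hA s χ hχ _ (hB1.trans hχs.symm) _ (B 1).2 v w h,
        hB1, hχs]
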